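/- Let $n\ge 1$, $v\in\mathbb C$, $v\neq 0$, and let $g:\mathbb Z/n\mathbb Z\to\mathbb C$ satisfy $g(0)=-v$ and $g(a)g(-a)=v$ for $a\neq 0$. Let $V_\Gamma$ be the complex vector space with basis $+_a$ ($a\in\mathbb Z/n\mathbb Z$) and $-$, and let $V_\Delta$ be the one with basis $-_a$ ($a\in\mathbb Z/n\mathbb Z$) and $+$ (an edge carries a spin $\pm$ and a charge mod $n$; the undecorated spin has charge $0$). For $X,Y\in\{\Gamma,\Delta\}$ and $z_1,z_2\in\mathbb C^\times$ let $R^{XY}=R^{XY}(z_1,z_2)\in\operatorname{End}(V_X\otimes V_Y)$ be $$R^{XY}(x\otimes y)=\sum_{x',y'} w^{XY}(x,y;x',y')\,x'\otimes y' ,$$ the sum being over basis vectors $x'$ of $V_X$ and $y'$ of $V_Y$, where the Boltzmann weights $w^{XY}$ are as follows, and every weight not listed is $0$. Write $\bar a\in\{1,\dots,n\}$ for the representative of $a\in\mathbb Z/n\mathbb Z$ in that range and $[a]\in\{0,\dots,n-1\}$ for the one in that range. $\Gamma\Gamma$ (with $a\ne b$): $w(+_a,+_a;+_a,+_a)=z_2^n-vz_1^n$;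 $w(+_b,+_a;+_b,+_a)=g(a-b)(z_1^n-z_2^n)$; $w(+_b,+_a;+_a,+_b)=(1-v)z_1^{[a-b]}z_2^{n-[a-b]}$; $w(-,-;-,-)=z_1^n-vz_2^n$; $w(+_a,-;+_a,-)=v(z_1^n-z_2^n)$; $w(-,+_a;-,+_a)=z_1^n-z_2^n$; $w(-,+_a;+_a,-)=(1-v)z_1^{\bar a}z_2^{n-\bar a}$; $w(+_a,-;-,+_a)=(1-v)z_1^{n-\bar a}z_2^{\bar a}$. $\Delta\Delta$ (with $a\ne b$): $w(+,+;+,+)=z_1^n-vz_2^n$; $w(-_a,-_b;-_b,-_a)=(1-v)z_1^{n-[a-b]}z_2^{[a-b]}$; $w(-_a,-_b;-_a,-_b)=g(a-b)(z_1^n-z_2^n)$; $w(-_a,-_a;-_a,-_a)=z_2^n-vz_1^n$; $w(+,-_a;+,-_a)=v(z_1^n-z_2^n)$; $w(-_a,+;-_a,+)=z_1^n-z_2^n$; $w(-_a,+;+,-_a)=(1-v)z_1^{n-\bar a+1}z_2^{\bar a-1}$; $w(+,-_a;-_a,+)=(1-v)z_1^{\bar a-1}z_2^{n-\bar a+1}$.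 $\Gamma\Delta$: $w(+_a,+;+_a,+)=w(-,-_a;-,-_a)=z_1^n-vz_2^n$; $w(-,+;-,+)=z_1^n-z_2^n$; $w(+_a,-_b;+_a,-_b)=v^2z_2^n-z_1^n$ if $a+b=1$, and $=g(a+b-1)(z_1^n-vz_2^n)$ if $a+b\ne1$; if $a+b=c+d=1$ and $a\neq c$, then $w(+_a,-_b;+_c,-_d)$ is $(v-1)z_1^{n-e}z_2^{e}$ when $\bar a>\bar c$ and $v(v-1)z_1^{n-e}z_2^{e}$ when $\bar a<\bar c$, where $e=[a-c]$; if $a+b=1$, then $w(-,+;+_a,-_b)=(1-v)z_1^{\bar a}z_2^{\bar b-1}$ and $w(+_b,-_a;-,+)=(1-v)z_1^{\bar a-1}z_2^{\bar b}$. $\Delta\Gamma$: $w(+,+_a;+,+_a)=w(-_a,-;-_a,-)=z_2^n-v^nz_1^n$; $w(+,-;+,-)=z_2^n-v^{n+1}z_1^n$; $w(-_a,+_b;-_a,+_b)=v^{n-1}z_1^n-z_2^n$ if $a+b=1$, and $=(z_2^n-v^nz_1^n)/g(a+b-1)$ if $a+b\neq1$; if $a+b=c+d=1$ and $a\ne c$,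 then $w(-_a,+_b;-_c,+_d)=(1-v)v^{e-1}z_1^{e}z_2^{n-e}$, where $e=[c-a]$; if $a+b=1$, then $w(-_b,+_a;+,-)=(1-v)v^{\bar a-1}z_1^{\bar a}z_2^{\bar b-1}$ and $w(+,-;-_a,+_b)=(1-v)v^{\bar a-1}z_1^{\bar a-1}z_2^{\bar b}$. For parametrized endomorphisms $A\in\operatorname{End}(U\otimes V)$, $B\in\operatorname{End}(U\otimes W)$, $C\in\operatorname{End}(V\otimes W)$ put $$\llbracket A,B,C\rrbracket=A_{12}(z_1,z_2)B_{13}(z_1,z_3)C_{23}(z_2,z_3)-C_{23}(z_2,z_3)B_{13}(z_1,z_3)A_{12}(z_1,z_2)\in\operatorname{End}(U\otimes V\otimes W),$$ where the subscripts indicate the tensor factors acted upon, and put $A^\ddagger(z_1,z_2)=\tau A(z_2,z_1)\tau$, where $\tau(x\otimes y)=y\otimes x$. **Theorem.** (i) The endomorphism $R^{\Delta\Gamma}(z_1,z_2)$ is invertible whenever $z_2^n\ne v^nz_1^n$ and $z_2^n\neq vz_1^n$. (ii) Let $A=R^{\Gamma\Gamma}$, $B=(R^{\Delta\Gamma})^{-1}$,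 $C=R^{\Gamma\Delta}$, $D=(R^{\Delta\Delta})^\ddagger$. Then $A,B,C,D$ form a parametrized Yang–Baxter system: for all $z_1,z_2,z_3\in\mathbb C^\times$ for which the inverses that occur exist, $$\llbracket A,A,A\rrbracket=0,\quad \llbracket A,C,C\rrbracket=0,\quad \llbracket A,B^\ddagger,B^\ddagger\rrbracket=0,\quad \llbracket A,C,B^\ddagger\rrbracket=0,$$ $$\llbracket D,D,D\rrbracket=0,\quad \llbracket D,B,B\rrbracket=0,\quad \llbracket D,C^\ddagger,C^\ddagger\rrbracket=0,\quad \llbracket D,B,C^\ddagger\rrbracket=0.$$ (iii) There is a scalar $c(z_1,z_2)$, depending only on $z_1,z_2$ (and on $n,v,g$), such that for all $z_1,z_2\in\mathbb C^\times$ for which $R^{\Delta\Gamma}(z_1,z_2)$ is invertible, $c(z_1,z_2)\neq0$ and $$(R^{\Gamma\Delta})^\ddagger(z_1,z_2)=c(z_1,z_2)\,(R^{\Delta\Gamma}(z_1,z_2))^{-1}.$$ -/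

import Mathlib

open scoped Matrix

/-- Decorated horizontal edges of Gamma ice of nonzero weight: spin `+` with any charge mod `n`,
or spin `-` with charge `0`. They index the basis of the `(n+1)`-dimensional space `V_Γ`. -/
inductive GammaEdge (n : ℕ) : Type
  | plus (a : ZMod n)
  | minus
  deriving DecidableEq

/-- Decorated horizontal edges of Delta ice of nonzero weight: spin `-` with any charge mod `n`,
or spin `+` with charge `0`. They index the basis of the `(n+1)`-dimensional space `V_Δ`. -/
inductive DeltaEdge (n : ℕ) : Type
  | minus (a : ZMod n)
  | plus
  deriving DecidableEq

def GammaEdge.equivOption (n : ℕ) : Option (ZMod n) ≃ GammaEdge n where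
  toFun x := match x with
    | some a => .plus a
    | none => .minus
  invFun e := match e with
    | .plus a => some a
    | .minus => none
  left_inv x := by cases x <;> rfl
  right_inv e := by cases e <;> rfl

def DeltaEdge.equivOption (n : ℕ) : Option (ZMod n) ≃ DeltaEdge n where
  toFun x := match x with
    | some a => .minus a
    | none => .plus
  invFun e := match e with
    | .minus a => some a
    | .plus => none
  left_inv x := by cases x <;> rfl
  right_inv e := by cases e <;> rfl

instance GammaEdge.instFintype (n : ℕ) [NeZero n] : Fintype (GammaEdge n) :=
  Fintype.ofEquiv (Option (ZMod n)) (GammaEdge.equivOption n)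

instance DeltaEdge.instFintype (n : ℕ) [NeZero n] : Fintype (DeltaEdge n) :=
  Fintype.ofEquiv (Option (ZMod n)) (DeltaEdge.equivOption n)

/-- The representative in `[1, n]` of a charge mod `n`. (`ZMod.val` is the one in `[0, n - 1]`.) -/
def posRep {n : ℕ} (a : ZMod n) : ℕ := if a = 0 then n else a.val

/-! ### Boltzmann weights of the tilted vertices

In `weightXY v g z₁ z₂ sw nw ne se` the southwest and northeast edges are of type `X` (with
parameter `z₁`), the northwest and southeast edges are of type `Y` (with parameter `z₂`). -/

/-- Weights of `ΓΓ` vertices. -/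
noncomputable def weightGammaGamma {n : ℕ} (v : ℂ) (g : ZMod n → ℂ) (z₁ z₂ : ℂ) :
    GammaEdge n → GammaEdge n → GammaEdge n → GammaEdge n → ℂ
  | .plus b, .plus a, .plus c, .plus d =>
      if a = b then
        if c = a ∧ d = a then z₂ ^ n - v * z₁ ^ n else 0
      else if c = b ∧ d = a then g (a - b) * (z₁ ^ n - z₂ ^ n)
      else if c = a ∧ d = b then (1 - v) * z₁ ^ (a - b).val * z₂ ^ (n - (a - b).val)
      else 0
  | .minus, .minus, .minus, .minus => z₁ ^ n - v * z₂ ^ n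
  | .plus a, .minus, .plus c, .minus => if a = c then v * (z₁ ^ n - z₂ ^ n) else 0
  | .minus, .plus a, .minus, .plus d => if a = d then z₁ ^ n - z₂ ^ n else 0
  | .minus, .plus a, .plus c, .minus =>
      if a = c then (1 - v) * z₁ ^ posRep a * z₂ ^ (n - posRep a) else 0
  | .plus a, .minus, .minus, .plus d =>
      if a = d then (1 - v) * z₁ ^ (n - posRep a) * z₂ ^ posRep a else 0
  | _, _, _, _ => 0

/-- Weights of `ΔΔ` vertices. -/
noncomputable def weightDeltaDelta {n : ℕ} (v : ℂ) (g : ZMod n → ℂ) (z₁ z₂ : ℂ) :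
    DeltaEdge n → DeltaEdge n → DeltaEdge n → DeltaEdge n → ℂ
  | .plus, .plus, .plus, .plus => z₁ ^ n - v * z₂ ^ n
  | .minus a, .minus b, .minus c, .minus d =>
      if a = b then
        if c = a ∧ d = a then z₂ ^ n - v * z₁ ^ n else 0
      else if c = b ∧ d = a then (1 - v) * z₁ ^ (n - (a - b).val) * z₂ ^ (a - b).val
      else if c = a ∧ d = b then g (a - b) * (z₁ ^ n - z₂ ^ n)
      else 0
  | .plus, .minus a, .plus, .minus d => if a = d then v * (z₁ ^ n - z₂ ^ n) else 0
  | .minus a, .plus, .plus, .minus d =>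
      if a = d then (1 - v) * z₁ ^ (n - posRep a + 1) * z₂ ^ (posRep a - 1) else 0
  | .minus a, .plus, .minus c, .plus => if a = c then z₁ ^ n - z₂ ^ n else 0
  | .plus, .minus a, .minus c, .plus =>
      if a = c then (1 - v) * z₁ ^ (posRep a - 1) * z₂ ^ (n - posRep a + 1) else 0
  | _, _, _, _ => 0

/-- Weights of `ΓΔ` vertices. In the case `a + b ≡ c + d ≡ 1`, `a ≢ c`, the weight depends on
whether `ad = 0`, or `abcd ≠ 0` and `a > c` (representatives in `[0, n - 1]`); as `d = 0` means
`c = 1`, this says that the representative of `a` in `[1, n]` exceeds that of `c`. -/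
noncomputable def weightGammaDelta {n : ℕ} (v : ℂ) (g : ZMod n → ℂ) (z₁ z₂ : ℂ) :
    GammaEdge n → DeltaEdge n → GammaEdge n → DeltaEdge n → ℂ
  | .plus a, .plus, .plus c, .plus => if a = c then z₁ ^ n - v * z₂ ^ n else 0
  | .minus, .minus a, .minus, .minus d => if a = d then z₁ ^ n - v * z₂ ^ n else 0
  | .plus a, .minus b, .plus c, .minus d =>
      if a = c ∧ b = d then
        if a + b = 1 then v ^ 2 * z₂ ^ n - z₁ ^ n
        else g (a + b - 1) * (z₁ ^ n - v * z₂ ^ n)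
      else if a + b = 1 ∧ c + d = 1 then
        if posRep c < posRep a then (v - 1) * z₁ ^ (n - (a - c).val) * z₂ ^ (a - c).val
        else v * (v - 1) * z₁ ^ (n - (a - c).val) * z₂ ^ (a - c).val
      else 0
  | .minus, .plus, .minus, .plus => z₁ ^ n - z₂ ^ n
  | .minus, .plus, .plus a, .minus b =>
      if a + b = 1 then (1 - v) * z₁ ^ posRep a * z₂ ^ (posRep b - 1) else 0
  | .plus b, .minus a, .minus, .plus =>
      if a + b = 1 then (1 - v) * z₁ ^ (posRep a - 1) * z₂ ^ posRep b else 0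
  | _, _, _, _ => 0

/-- Weights of `ΔΓ` vertices. -/
noncomputable def weightDeltaGamma {n : ℕ} (v : ℂ) (g : ZMod n → ℂ) (z₁ z₂ : ℂ) :
    DeltaEdge n → GammaEdge n → DeltaEdge n → GammaEdge n → ℂ
  | .plus, .plus a, .plus, .plus d => if a = d then z₂ ^ n - v ^ n * z₁ ^ n else 0
  | .minus a, .minus, .minus c, .minus => if a = c then z₂ ^ n - v ^ n * z₁ ^ n else 0
  | .plus, .minus, .plus, .minus => z₂ ^ n - v ^ (n + 1) * z₁ ^ n
  | .minus a, .plus b, .minus c, .plus d =>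
      if a = c ∧ b = d then
        if a + b = 1 then v ^ (n - 1) * z₁ ^ n - z₂ ^ n
        else (z₂ ^ n - v ^ n * z₁ ^ n) / g (a + b - 1)
      else if a + b = 1 ∧ c + d = 1 then
        (1 - v) * v ^ ((c - a).val - 1) * z₁ ^ (c - a).val * z₂ ^ (n - (c - a).val)
      else 0
  | .minus b, .plus a, .plus, .minus =>
      if a + b = 1 then (1 - v) * v ^ (posRep a - 1) * z₁ ^ posRep a * z₂ ^ (posRep b - 1) else 0
  | .plus, .minus, .minus a, .plus b =>
      if a + b = 1 then (1 - v) * v ^ (posRep a - 1) * z₁ ^ (posRep a - 1) * z₂ ^ posRep b else 0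
  | _, _, _, _ => 0

/-! ### The R-matrices

A square matrix indexed by `ι × κ` is an endomorphism of `ℂ^ι ⊗ ℂ^κ`. The column of `R^{XY}` is
(southwest, northwest), the row is (northeast, southeast). -/

noncomputable def RGammaGamma {n : ℕ} (v : ℂ) (g : ZMod n → ℂ) (z₁ z₂ : ℂˣ) :
    Matrix (GammaEdge n × GammaEdge n) (GammaEdge n × GammaEdge n) ℂ :=
  Matrix.of fun p q => weightGammaGamma v g z₁ z₂ q.1 q.2 p.1 p.2

noncomputable def RDeltaDelta {n : ℕ} (v : ℂ) (g : ZMod n → ℂ) (z₁ z₂ : ℂˣ) :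
    Matrix (DeltaEdge n × DeltaEdge n) (DeltaEdge n × DeltaEdge n) ℂ :=
  Matrix.of fun p q => weightDeltaDelta v g z₁ z₂ q.1 q.2 p.1 p.2

noncomputable def RGammaDelta {n : ℕ} (v : ℂ) (g : ZMod n → ℂ) (z₁ z₂ : ℂˣ) :
    Matrix (GammaEdge n × DeltaEdge n) (GammaEdge n × DeltaEdge n) ℂ :=
  Matrix.of fun p q => weightGammaDelta v g z₁ z₂ q.1 q.2 p.1 p.2

noncomputable def RDeltaGamma {n : ℕ} (v : ℂ) (g : ZMod n → ℂ) (z₁ z₂ : ℂˣ) :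
    Matrix (DeltaEdge n × GammaEdge n) (DeltaEdge n × GammaEdge n) ℂ :=
  Matrix.of fun p q => weightDeltaGamma v g z₁ z₂ q.1 q.2 p.1 p.2

/-! ### Yang-Baxter systems -/

/-- Parametrized endomorphisms of `ℂ^ι ⊗ ℂ^κ`. -/
abbrev ParamEnd (ι κ : Type) : Type := ℂˣ → ℂˣ → Matrix (ι × κ) (ι × κ) ℂ

/-- `A₁₂`: the endomorphism `A` on the first two tensor factors, the identity on the third. -/
def act12 {ι κ μ : Type} [DecidableEq μ] (A : Matrix (ι × κ) (ι × κ) ℂ) :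
    Matrix (ι × κ × μ) (ι × κ × μ) ℂ :=
  Matrix.of fun p q => if p.2.2 = q.2.2 then A (p.1, p.2.1) (q.1, q.2.1) else 0

/-- `B₁₃`: the endomorphism `B` on the outer tensor factors, the identity on the second. -/
def act13 {ι κ μ : Type} [DecidableEq κ] (B : Matrix (ι × μ) (ι × μ) ℂ) :
    Matrix (ι × κ × μ) (ι × κ × μ) ℂ :=
  Matrix.of fun p q => if p.2.1 = q.2.1 then B (p.1, p.2.2) (q.1, q.2.2) else 0

/-- `C₂₃`: the endomorphism `C` on the last two tensor factors, the identity on the first. -/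
def act23 {ι κ μ : Type} [DecidableEq ι] (C : Matrix (κ × μ) (κ × μ) ℂ) :
    Matrix (ι × κ × μ) (ι × κ × μ) ℂ :=
  Matrix.of fun p q => if p.1 = q.1 then C p.2 q.2 else 0

/-- The Yang-Baxter commutator `⟦A, B, C⟧` at the parameters `z₁, z₂, z₃`. -/
def ybCommutator {ι κ μ : Type} [Fintype ι] [Fintype κ] [Fintype μ]
    [DecidableEq ι] [DecidableEq κ] [DecidableEq μ]
    (A : ParamEnd ι κ) (B : ParamEnd ι μ) (C : ParamEnd κ μ) (z₁ z₂ z₃ : ℂˣ) :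
    Matrix (ι × κ × μ) (ι × κ × μ) ℂ :=
  act12 (A z₁ z₂) * act13 (B z₁ z₃) * act23 (C z₂ z₃)
    - act23 (C z₂ z₃) * act13 (B z₁ z₃) * act12 (A z₁ z₂)

/-- The flip operator `x ⊗ y ↦ y ⊗ x`. -/
def flipOp (ι κ : Type) [DecidableEq ι] [DecidableEq κ] : Matrix (κ × ι) (ι × κ) ℂ :=
  Matrix.of fun p q => if p = q.swap then 1 else 0

/-- `A^‡(z₁, z₂) = τ A(z₂, z₁) τ`. -/
def ddagger {ι κ : Type} [Fintype ι] [Fintype κ] [DecidableEq ι] [DecidableEq κ]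
    (A : ParamEnd ι κ) : ParamEnd κ ι :=
  fun z₁ z₂ => flipOp ι κ * A z₂ z₁ * flipOp κ ι

/-- `A, B, C, D` form a parametrized Yang-Baxter system. -/
structure IsYangBaxterSystem {ι κ : Type} [Fintype ι] [Fintype κ] [DecidableEq ι] [DecidableEq κ]
    (A : ParamEnd ι ι) (B : ParamEnd κ ι) (C : ParamEnd ι κ) (D : ParamEnd κ κ) : Prop where
  aaa : ∀ z₁ z₂ z₃, ybCommutator A A A z₁ z₂ z₃ = 0
  acc : ∀ z₁ z₂ z₃, ybCommutator A C C z₁ z₂ z₃ = 0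
  abb : ∀ z₁ z₂ z₃, ybCommutator A (ddagger B) (ddagger B) z₁ z₂ z₃ = 0
  acb : ∀ z₁ z₂ z₃, ybCommutator A C (ddagger B) z₁ z₂ z₃ = 0
  ddd : ∀ z₁ z₂ z₃, ybCommutator D D D z₁ z₂ z₃ = 0
  dbb : ∀ z₁ z₂ z₃, ybCommutator D B B z₁ z₂ z₃ = 0
  dcc : ∀ z₁ z₂ z₃, ybCommutator D (ddagger C) (ddagger C) z₁ z₂ z₃ = 0
  dbc : ∀ z₁ z₂ z₃, ybCommutator D B (ddagger C) z₁ z₂ z₃ = 0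

/-! All eight equations come from one solution, the Perk-Schultz R-matrix with `n` labels of one
parity and one of the other, in the variables `zᵢ ^ n`. Conjugating it by the diagonal matrices with
entries `z ^ rank`, for the order `-, +₁, …, +ₙ`, gives `R^{ΓΓ}` (`RGammaGamma_eq_perkSchultz`).
This settles `⟦A, A, A⟧ = 0`.

Two symmetries of the Yang-Baxter equation supply the rest. Crossing: transposing the auxiliary
factor of `R^{ΓΓ}` and shifting its parameter by an `n`-th root `u` of `v` gives `R^{ΓΔ}`, under the
duality `-_b ↦ +_{1-b}`, `+ ↦ -` (`RGammaDelta_eq_crossing`); hence `⟦A, C, C⟧ = 0`. Full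
transposition with inverted parameters carries `R^{ΓΓ}` to `(R^{ΔΔ})^‡` and `R^{ΓΔ}` to
`(R^{ΓΔ})^‡`, up to a scalar and a gauge (`ddagger_RDeltaDelta_eq`, `ddagger_RGammaDelta_eq`); hence
`⟦D, D, D⟧ = 0` and `⟦D, C^‡, C^‡⟧ = 0`.

Finally `R^{ΔΓ} (R^{ΓΔ})^‡` is the scalar `(z₂ⁿ - vⁿ z₁ⁿ)(z₂ⁿ - v z₁ⁿ)`
(`RDeltaGamma_mul_ddagger_RGammaDelta`). Both factors are diagonal apart from one block of size `n +
1`, where the product reduces to telescoping geometric sums. So `B` is proportional to `C^‡`, the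
four equations containing `B` are rescalings of those containing only `C`, and the claims on
invertibility and proportionality follow. -/

/-! ### Symmetries of the Yang-Baxter equation -/

section YangBaxterEquation

variable {ι κ μ ι' κ' μ' : Type} [Fintype ι] [Fintype κ] [Fintype μ]

/-- The entries of `A₁₂ B₁₃ C₂₃`. -/
def ybLeft (A : Matrix (ι × κ) (ι × κ) ℂ) (B : Matrix (ι × μ) (ι × μ) ℂ)
    (C : Matrix (κ × μ) (κ × μ) ℂ) (i : ι) (j : κ) (k : μ) (i' : ι) (j' : κ) (k' : μ) : ℂ :=
  ∑ t : ι × κ × μ, A (i, j) (t.1, t.2.1) * B (t.1, k) (i', t.2.2) * C (t.2.1, t.2.2) (j', k')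

/-- The entries of `C₂₃ B₁₃ A₁₂`. -/
def ybRight (A : Matrix (ι × κ) (ι × κ) ℂ) (B : Matrix (ι × μ) (ι × μ) ℂ)
    (C : Matrix (κ × μ) (κ × μ) ℂ) (i : ι) (j : κ) (k : μ) (i' : ι) (j' : κ) (k' : μ) : ℂ :=
  ∑ t : ι × κ × μ, C (j, k) (t.2.1, t.2.2) * B (i, t.2.2) (t.1, k') * A (t.1, t.2.1) (i', j')

theorem act12_mul_act13_mul_act23_apply [DecidableEq ι] [DecidableEq κ]
    [DecidableEq μ] (A : Matrix (ι × κ) (ι × κ) ℂ)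
    (B : Matrix (ι × μ) (ι × μ) ℂ) (C : Matrix (κ × μ) (κ × μ) ℂ) (p q : ι × κ × μ) :
    (act12 A * act13 B * act23 C : Matrix (ι × κ × μ) (ι × κ × μ) ℂ) p q =
      ybLeft A B C p.1 p.2.1 p.2.2 q.1 q.2.1 q.2.2 := by
  simp only [Matrix.mul_apply, act12, act13, act23, Matrix.of_apply, ybLeft,
    Fintype.sum_prod_type, ite_mul, mul_ite, zero_mul, mul_zero]
  simp [Finset.sum_mul]
  exact (Finset.sum_congr rfl fun x _ => Finset.sum_comm).trans Finset.sum_comm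

theorem act23_mul_act13_mul_act12_apply [DecidableEq ι] [DecidableEq κ]
    [DecidableEq μ] (A : Matrix (ι × κ) (ι × κ) ℂ)
    (B : Matrix (ι × μ) (ι × μ) ℂ) (C : Matrix (κ × μ) (κ × μ) ℂ) (p q : ι × κ × μ) :
    (act23 C * act13 B * act12 A : Matrix (ι × κ × μ) (ι × κ × μ) ℂ) p q =
      ybRight A B C p.1 p.2.1 p.2.2 q.1 q.2.1 q.2.2 := by
  simp only [Matrix.mul_apply, act12, act13, act23, Matrix.of_apply, ybRight,
    Fintype.sum_prod_type, ite_mul, mul_ite, zero_mul, mul_zero,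
    Finset.sum_ite_eq', Finset.mem_univ, if_true]
  simp [Finset.sum_mul]

/-- The parametrized Yang-Baxter equation `A₁₂ B₁₃ C₂₃ = C₂₃ B₁₃ A₁₂`. -/
def SatisfiesYBE (A : ParamEnd ι κ) (B : ParamEnd ι μ) (C : ParamEnd κ μ) : Prop :=
  ∀ z₁ z₂ z₃ i j k i' j' k',
    ybLeft (A z₁ z₂) (B z₁ z₃) (C z₂ z₃) i j k i' j' k' =
      ybRight (A z₁ z₂) (B z₁ z₃) (C z₂ z₃) i j k i' j' k'

theorem satisfiesYBE_iff [DecidableEq ι] [DecidableEq κ] [DecidableEq μ]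
    {A : ParamEnd ι κ} {B : ParamEnd ι μ} {C : ParamEnd κ μ} :
    SatisfiesYBE A B C ↔ ∀ z₁ z₂ z₃, ybCommutator A B C z₁ z₂ z₃ = 0 := by
  unfold SatisfiesYBE ybCommutator
  refine forall_congr' fun z₁ => forall_congr' fun z₂ => forall_congr' fun z₃ => ?_
  rw [sub_eq_zero, ← Matrix.ext_iff]
  simp only [act12_mul_act13_mul_act23_apply, act23_mul_act13_mul_act12_apply, Prod.forall]

theorem ddagger_apply [DecidableEq ι] [DecidableEq κ] (A : ParamEnd ι κ) (z₁ z₂ : ℂˣ) (p q : κ × ι) :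
    ddagger A z₁ z₂ p q = A z₂ z₁ p.swap q.swap := by
  simp only [ddagger, flipOp, Matrix.mul_apply, Matrix.of_apply]
  rw [Finset.sum_eq_single q.swap, Finset.sum_eq_single p.swap]
  · simp
  · intro b _ hb
    rw [if_neg, zero_mul]
    rintro rfl
    simp at hb
  · simp
  · intro b _ hb
    rw [if_neg hb, mul_zero]
  · simp

/-- Rescaling, and conjugation by diagonal matrices that depend on the parameters. -/
theorem SatisfiesYBE.gauge {A A' : ParamEnd ι κ} {B B' : ParamEnd ι μ} {C C' : ParamEnd κ μ}
    (h : SatisfiesYBE A B C) (r s t : ℂˣ → ℂˣ → ℂ) (d : ℂˣ → ι → ℂˣ) (e : ℂˣ → κ → ℂˣ)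
    (f : ℂˣ → μ → ℂˣ)
    (hA : ∀ z₁ z₂ p q, A' z₁ z₂ p q =
      r z₁ z₂ * (d z₁ p.1 * e z₂ p.2 * ((d z₁ q.1)⁻¹ * (e z₂ q.2)⁻¹) : ℂˣ) * A z₁ z₂ p q)
    (hB : ∀ z₁ z₂ p q, B' z₁ z₂ p q =
      s z₁ z₂ * (d z₁ p.1 * f z₂ p.2 * ((d z₁ q.1)⁻¹ * (f z₂ q.2)⁻¹) : ℂˣ) * B z₁ z₂ p q)
    (hC : ∀ z₁ z₂ p q, C' z₁ z₂ p q =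
      t z₁ z₂ * (e z₁ p.1 * f z₂ p.2 * ((e z₁ q.1)⁻¹ * (f z₂ q.2)⁻¹) : ℂˣ) * C z₁ z₂ p q) :
    SatisfiesYBE A' B' C' := by
  intro z₁ z₂ z₃ i j k i' j' k'
  -- The gauge factors at the summed indices cancel, so both sides acquire the same factor,
  -- depending only on the outer indices.
  have key := congrArg (fun w => r z₁ z₂ * s z₁ z₃ * t z₂ z₃ *
    ((d z₁ i * e z₂ j * f z₃ k * ((d z₁ i')⁻¹ * (e z₂ j')⁻¹ * (f z₃ k')⁻¹) : ℂˣ) : ℂ) * w)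
    (h z₁ z₂ z₃ i j k i' j' k')
  simp only [ybLeft, ybRight, Finset.mul_sum] at key ⊢
  convert key using 2 with x _ x _
  · simp only [hA, hB, hC]
    push_cast
    field_simp
  · simp only [hA, hB, hC]
    push_cast
    field_simp

theorem SatisfiesYBE.smul {A : ParamEnd ι κ} {B B' : ParamEnd ι μ} {C C' : ParamEnd κ μ}
    (h : SatisfiesYBE A B C) (s t : ℂˣ → ℂˣ → ℂ)
    (hB : ∀ z₁ z₂, B' z₁ z₂ = s z₁ z₂ • B z₁ z₂) (hC : ∀ z₁ z₂, C' z₁ z₂ = t z₁ z₂ • C z₁ z₂) :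
    SatisfiesYBE A B' C' :=
  h.gauge (fun _ _ => 1) s t (fun _ _ => 1) (fun _ _ => 1) (fun _ _ => 1)
    (by simp) (by simp [hB]) (by simp [hC])

/-- Transposition, combined with a relabelling of the bases, an inversion of the parameters,
rescaling and conjugation by diagonal matrices. -/
theorem SatisfiesYBE.transpose [Fintype ι'] [Fintype κ'] [Fintype μ']
    {A : ParamEnd ι κ} {B : ParamEnd ι μ} {C : ParamEnd κ μ}
    {A' : ParamEnd ι' κ'} {B' : ParamEnd ι' μ'} {C' : ParamEnd κ' μ'}
    (h : SatisfiesYBE A B C) (φ : ι' ≃ ι) (χ : κ' ≃ κ) (ψ : μ' ≃ μ) (r s t : ℂˣ → ℂˣ → ℂ)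
    (d : ℂˣ → ι' → ℂˣ) (e : ℂˣ → κ' → ℂˣ) (f : ℂˣ → μ' → ℂˣ)
    (hA : ∀ z₁ z₂ p q, A' z₁ z₂ p q =
      r z₁ z₂ * (d z₁ p.1 * e z₂ p.2 * ((d z₁ q.1)⁻¹ * (e z₂ q.2)⁻¹) : ℂˣ) *
        A z₁⁻¹ z₂⁻¹ (φ q.1, χ q.2) (φ p.1, χ p.2))
    (hB : ∀ z₁ z₂ p q, B' z₁ z₂ p q =
      s z₁ z₂ * (d z₁ p.1 * f z₂ p.2 * ((d z₁ q.1)⁻¹ * (f z₂ q.2)⁻¹) : ℂˣ) *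
        B z₁⁻¹ z₂⁻¹ (φ q.1, ψ q.2) (φ p.1, ψ p.2))
    (hC : ∀ z₁ z₂ p q, C' z₁ z₂ p q =
      t z₁ z₂ * (e z₁ p.1 * f z₂ p.2 * ((e z₁ q.1)⁻¹ * (f z₂ q.2)⁻¹) : ℂˣ) *
        C z₁⁻¹ z₂⁻¹ (χ q.1, ψ q.2) (χ p.1, ψ p.2)) :
    SatisfiesYBE A' B' C' := by
  intro z₁ z₂ z₃ i j k i' j' k'
  -- Transposition reverses products, so the two sides of the equation trade places and the outer
  -- indices trade roles.
  have key := congrArg (fun w => r z₁ z₂ * s z₁ z₃ * t z₂ z₃ *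
    ((d z₁ i * e z₂ j * f z₃ k * ((d z₁ i')⁻¹ * (e z₂ j')⁻¹ * (f z₃ k')⁻¹) : ℂˣ) : ℂ) * w)
    (h z₁⁻¹ z₂⁻¹ z₃⁻¹ (φ i') (χ j') (ψ k') (φ i) (χ j) (ψ k)).symm
  simp only [ybLeft, ybRight, Finset.mul_sum] at key ⊢
  convert key using 1
  · refine Fintype.sum_equiv (φ.prodCongr (χ.prodCongr ψ)) _ _ fun x => ?_
    simp only [hA, hB, hC, Equiv.prodCongr_apply, Prod.map]
    push_cast
    field_simp
  · refine Fintype.sum_equiv (φ.prodCongr (χ.prodCongr ψ)) _ _ fun x => ?_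
    simp only [hA, hB, hC, Equiv.prodCongr_apply, Prod.map]
    push_cast
    field_simp

/-- Crossing: the partial transpose of `A₂₁` in the second factor solves `⟦A, C, C⟧ = 0`. -/
theorem SatisfiesYBE.crossing {A : ParamEnd ι ι} (h : SatisfiesYBE A A A) (ψ : μ ≃ ι)
    (u : ℂˣ) (x y : ι → ℂ)
    (hx : ∀ z₁ z₂ p q, A z₁ z₂ p q ≠ 0 → x p.1 * x p.2 = x q.1 * x q.2)
    (hy : ∀ z₁ z₂ p q, A z₁ z₂ p q ≠ 0 → y p.1 * y p.2 = y q.1 * y q.2)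
    {C : ParamEnd ι μ}
    (hC : ∀ z₁ z₂ p q, C z₁ z₂ p q =
      x p.1 * y q.1 * A (u * z₂) z₁ (ψ q.2, p.1) (ψ p.2, q.1)) :
    SatisfiesYBE A C C := by
  intro z₁ z₂ z₃ i j k i' j' k'
  -- The third factor becomes the first, with parameter `u * z₃`; transposing in it alone
  -- interchanges `k` and `k'` and reverses the order of the two operators acting on it. The
  -- conservation laws `hx` and `hy` replace the weights at summed indices by those at outer ones.
  have key := congrArg (fun w => x i * x j * (y i' * y j') * w)
    (h (u * z₃) z₁ z₂ (ψ k') i j (ψ k) i' j').symm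
  simp only [ybLeft, ybRight, Finset.mul_sum] at key ⊢
  convert key using 1
  · refine Fintype.sum_equiv ⟨fun s => (ψ s.2.2, s.1, s.2.1), fun s => (s.2.1, s.2.2, ψ.symm s.1),
      fun s => by simp, fun s => by simp⟩ _ _ fun s => ?_
    simp only [hC, Equiv.coe_fn_mk]
    by_cases h0 : A z₁ z₂ (i, j) (s.1, s.2.1) = 0
    · simp [h0]
    · linear_combination (-A z₁ z₂ (i, j) (s.1, s.2.1) * y i' * y j' *
        A (u * z₃) z₁ (ψ s.2.2, s.1) (ψ k, i') * A (u * z₃) z₂ (ψ k', s.2.1) (ψ s.2.2, j')) *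
          hx _ _ _ _ h0
  · refine Fintype.sum_equiv ⟨fun s => (ψ s.2.2, s.1, s.2.1), fun s => (s.2.1, s.2.2, ψ.symm s.1),
      fun s => by simp, fun s => by simp⟩ _ _ fun s => ?_
    simp only [hC, Equiv.coe_fn_mk]
    by_cases h0 : A z₁ z₂ (s.1, s.2.1) (i', j') = 0
    · simp [h0]
    · linear_combination (A z₁ z₂ (s.1, s.2.1) (i', j') * x i * x j *
        A (u * z₃) z₁ (ψ k', i) (ψ s.2.2, s.1) * A (u * z₃) z₂ (ψ s.2.2, j) (ψ k, s.2.1)) *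
          hy _ _ _ _ h0

end YangBaxterEquation

/-! ### The Perk-Schultz solution -/

section PerkSchultz

variable {ι : Type}

/-- The entries of the Perk-Schultz R-matrix in position `(i, j), (j, i)`. -/
noncomputable def perkSchultzSwap (v : ℂ) (r : ι → ℕ) (x y : ℂ) (i j : ι) : ℂ :=
  if r i = r j then 0 else (1 - v) * (if r j < r i then y else x)

theorem perkSchultzSwap_self (v : ℂ) (r : ι → ℕ) (x y : ℂ) (i : ι) :
    perkSchultzSwap v r x y i i = 0 := if_pos rfl

theorem perkSchultzSwap_of_lt (v : ℂ) (r : ι → ℕ) (x y : ℂ) {i j : ι} (h : r i < r j) :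
    perkSchultzSwap v r x y i j = (1 - v) * x := by
  simp [perkSchultzSwap, h.ne, h.not_gt]

theorem perkSchultzSwap_of_gt (v : ℂ) (r : ι → ℕ) (x y : ℂ) {i j : ι} (h : r j < r i) :
    perkSchultzSwap v r x y i j = (1 - v) * y := by
  simp [perkSchultzSwap, h.ne', h]

variable [DecidableEq ι]

/-- The diagonal entries of the Perk-Schultz R-matrix. -/
def perkSchultzDiag (v : ℂ) (γ : ι → ι → ℂ) (σ : ι → Bool) (x y : ℂ) (i j : ι) : ℂ :=
  if i = j then (if σ i then y - v * x else x - v * y) else γ i j * (x - y)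

/-- The twisted R-matrix of `U_q(gl(p|q))`, with parameters `x, y` and `q² = v`. -/
noncomputable def perkSchultz (v : ℂ) (γ : ι → ι → ℂ) (σ : ι → Bool) (r : ι → ℕ) (x y : ℂ) :
    Matrix (ι × ι) (ι × ι) ℂ :=
  Matrix.of fun p q => (if q = p then perkSchultzDiag v γ σ x y p.1 p.2 else 0) +
    (if q = p.swap then perkSchultzSwap v r x y p.1 p.2 else 0)

variable [Fintype ι] (v : ℂ) (γ : ι → ι → ℂ) (σ : ι → Bool) (r : ι → ℕ) (x y : ℂ)

theorem act12_perkSchultz_mulVec (f : ι × ι × ι → ℂ) (i j k : ι) :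
    (act12 (perkSchultz v γ σ r x y) *ᵥ f) (i, j, k) =
      perkSchultzDiag v γ σ x y i j * f (i, j, k) +
        perkSchultzSwap v r x y i j * f (j, i, k) := by
  simp [Matrix.mulVec, dotProduct, act12, perkSchultz, Fintype.sum_prod_type, add_mul,
    Finset.sum_add_distrib, ite_and]

theorem act13_perkSchultz_mulVec (f : ι × ι × ι → ℂ) (i j k : ι) :
    (act13 (perkSchultz v γ σ r x y) *ᵥ f) (i, j, k) =
      perkSchultzDiag v γ σ x y i k * f (i, j, k) +
        perkSchultzSwap v r x y i k * f (k, j, i) := by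
  simp [Matrix.mulVec, dotProduct, act13, perkSchultz, Fintype.sum_prod_type, add_mul,
    Finset.sum_add_distrib, ite_and]

theorem act23_perkSchultz_mulVec (f : ι × ι × ι → ℂ) (i j k : ι) :
    (act23 (perkSchultz v γ σ r x y) *ᵥ f) (i, j, k) =
      perkSchultzDiag v γ σ x y j k * f (i, j, k) +
        perkSchultzSwap v r x y j k * f (i, k, j) := by
  simp [Matrix.mulVec, dotProduct, act23, perkSchultz, Fintype.sum_prod_type, add_mul,
    Finset.sum_add_distrib]

variable {v γ r}

/-- The R-matrix only keeps or exchanges two labels, so at `(i, j, k)` both sides involve `f` only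
at permutations of this triple. The coefficients depend on which labels coincide, their parities and
the order of their ranks, which leaves finitely many polynomial identities. -/
theorem perkSchultz_ybe (hr : Function.Injective r) (hγ : ∀ i j, i ≠ j → γ i j * γ j i = v)
    (x y z : ℂ) :
    act12 (perkSchultz v γ σ r x y) * act13 (perkSchultz v γ σ r x z) *
        act23 (perkSchultz v γ σ r y z) =
      act23 (perkSchultz v γ σ r y z) * act13 (perkSchultz v γ σ r x z) *
        act12 (perkSchultz v γ σ r x y) := by
  refine Matrix.ext_of_mulVec_single fun q => ?_
  generalize (Pi.single q 1 : ι × ι × ι → ℂ) = f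
  ext ⟨i, j, k⟩
  simp only [← Matrix.mulVec_mulVec, act12_perkSchultz_mulVec, act13_perkSchultz_mulVec,
    act23_perkSchultz_mulVec]
  by_cases hij : i = j
  · subst hij
    by_cases hik : i = k
    · subst hik
      ring
    · have h := hγ i k hik
      have hr' := hr.ne hik
      simp only [perkSchultzDiag, perkSchultzSwap, hik, Ne.symm hik, hr', hr'.symm, if_true, if_false]
      rcases lt_or_gt_of_ne hr' with hlt | hlt <;> cases σ i <;>
        simp only [hlt, hlt.not_gt, if_true, if_false, Bool.false_eq_true] <;> grind
  · have hrij := hr.ne hij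
    have h1 := hγ i j hij
    by_cases hik : i = k
    · subst hik
      simp only [perkSchultzDiag, perkSchultzSwap, hij, Ne.symm hij, hrij, hrij.symm, if_true, if_false]
      rcases lt_or_gt_of_ne hrij with hlt | hlt <;> cases σ i <;>
        simp only [hlt, hlt.not_gt, if_true, if_false, Bool.false_eq_true] <;> grind
    · have hrik := hr.ne hik
      have h2 := hγ i k hik
      by_cases hjk : j = k
      · subst hjk
        simp only [perkSchultzDiag, perkSchultzSwap, hij, Ne.symm hij, hrij, hrij.symm, if_true, if_false]
        rcases lt_or_gt_of_ne hrij with hlt | hlt <;> cases σ j <;>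
          simp only [hlt, hlt.not_gt, if_true, if_false, Bool.false_eq_true] <;> grind
      · have hrjk := hr.ne hjk
        have h3 := hγ j k hjk
        simp only [perkSchultzDiag, perkSchultzSwap, hij, Ne.symm hij, hrij, hrij.symm, hik,
          hrik, hjk, Ne.symm hjk, hrjk, hrjk.symm, if_false]
        rcases lt_or_gt_of_ne hrij with hlt | hlt <;> rcases lt_or_gt_of_ne hrik with hlt' | hlt' <;>
          rcases lt_or_gt_of_ne hrjk with hlt'' | hlt'' <;>
          first
          | (exfalso; omega)
          | (simp only [hlt, hlt.not_gt, hlt', hlt'.not_gt, hlt'', hlt''.not_gt, if_true, if_false]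
             grind)

end PerkSchultz

/-! ### Representatives of charges in `[1, n]` -/

section PosRep

variable {n : ℕ} [NeZero n]

theorem posRep_pos (a : ZMod n) : 1 ≤ posRep a := by
  unfold posRep
  split_ifs with h
  · exact NeZero.one_le
  · exact Nat.one_le_iff_ne_zero.2 ((ZMod.val_ne_zero a).2 h)

theorem posRep_le (a : ZMod n) : posRep a ≤ n := by
  unfold posRep
  split_ifs with h
  · exact le_rfl
  · exact a.val_lt.le

theorem natCast_posRep (a : ZMod n) : (posRep a : ZMod n) = a := by
  unfold posRep
  split_ifs with h
  · simp [h]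
  · simp

theorem posRep_injective : Function.Injective (posRep : ZMod n → ℕ) := fun a b h => by
  rw [← natCast_posRep a, h, natCast_posRep]

theorem posRep_natCast {m : ℕ} (h1 : 1 ≤ m) (h2 : m ≤ n) : posRep (m : ZMod n) = m := by
  rcases h2.lt_or_eq with h | rfl
  · have hm : (m : ZMod n).val = m := ZMod.val_natCast_of_lt h
    rw [posRep, if_neg, hm]
    intro h0
    rw [h0, ZMod.val_zero] at hm
    omega
  · simp [posRep]

/-- On representatives in `[1, n]` the charge duality `a ↦ 1 - a` is the order-reversing involution;
this is the reason for preferring that range. -/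
theorem posRep_one_sub (a : ZMod n) : posRep (1 - a) = n + 1 - posRep a := by
  have h1 := posRep_pos a
  have h2 := posRep_le a
  have h : (1 - a : ZMod n) = ((n + 1 - posRep a : ℕ) : ZMod n) := by
    rw [Nat.cast_sub (by omega)]
    simp [natCast_posRep]
  rw [h, posRep_natCast (by omega) (by omega)]

theorem val_sub_of_posRep_le {a b : ZMod n} (h : posRep b ≤ posRep a) :
    (a - b).val = posRep a - posRep b := by
  have h1 := posRep_pos b
  have h2 := posRep_le a
  have h : (a - b : ZMod n) = ((posRep a - posRep b : ℕ) : ZMod n) := by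
    rw [Nat.cast_sub h]
    simp [natCast_posRep]
  rw [h, ZMod.val_natCast_of_lt (by omega)]

theorem val_sub_of_posRep_lt {a b : ZMod n} (h : posRep a < posRep b) :
    (a - b).val = n + posRep a - posRep b := by
  have h1 := posRep_pos a
  have h2 := posRep_le b
  have h : (a - b : ZMod n) = ((n + posRep a - posRep b : ℕ) : ZMod n) := by
    rw [Nat.cast_sub (by omega)]
    simp [natCast_posRep]
  rw [h, ZMod.val_natCast_of_lt (by omega)]

variable {z : ℂ}

theorem pow_sub_posRep (hz : z ≠ 0) (a : ZMod n) :
    z ^ (n - posRep a) = z ^ n * (z ^ posRep a)⁻¹ :=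
  pow_sub₀ z hz (posRep_le a)

theorem pow_posRep_sub_one (hz : z ≠ 0) (a : ZMod n) :
    z ^ (posRep a - 1) = z ^ posRep a * z⁻¹ := by
  rw [pow_sub₀ z hz (posRep_pos a), pow_one]

theorem pow_posRep_one_sub (hz : z ≠ 0) (a : ZMod n) :
    z ^ posRep (1 - a) = z ^ n * z * (z ^ posRep a)⁻¹ := by
  rw [posRep_one_sub, pow_sub₀ z hz ((posRep_le a).trans n.le_succ), pow_succ]

/-- Up to a wrap-around factor `z ^ n`, decided by the order of the representatives, the power is a
quotient of a function of `a` by a function of `b`. This is what lets a diagonal gauge absorb the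
charge-dependent exponents. -/
theorem pow_val_sub (hz : z ≠ 0) (a b : ZMod n) :
    z ^ (a - b).val =
      (if posRep b ≤ posRep a then 1 else z ^ n) * z ^ posRep a * (z ^ posRep b)⁻¹ := by
  split_ifs with h
  · rw [val_sub_of_posRep_le h, pow_sub₀ z hz h, one_mul]
  · rw [val_sub_of_posRep_lt (not_le.1 h),
      pow_sub₀ z hz ((posRep_le b).trans (Nat.le_add_right n _)), pow_add]

theorem pow_sub_val_sub (hz : z ≠ 0) (a b : ZMod n) :
    z ^ (n - (a - b).val) =
      (if posRep b ≤ posRep a then z ^ n else 1) * z ^ posRep b * (z ^ posRep a)⁻¹ := by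
  have : z ^ n ≠ 0 := pow_ne_zero n hz
  rw [pow_sub₀ z hz (a - b).val_lt.le, pow_val_sub hz]
  split_ifs <;> field_simp

end PosRep

/-! ### `R^{ΓΓ}` as a gauged Perk-Schultz matrix -/

section GammaGamma

variable {n : ℕ} (v : ℂ) (g : ZMod n → ℂ)

/-- The position of an edge of Gamma ice in the order `-, +₁, …, +ₙ`. -/
def GammaEdge.rank : GammaEdge n → ℕ
  | .plus a => posRep a
  | .minus => 0

def GammaEdge.isPlus : GammaEdge n → Bool
  | .plus _ => true
  | .minus => false

/-- The twist that turns the Perk-Schultz R-matrix into `R^{ΓΓ}`. -/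
def GammaEdge.twist : GammaEdge n → GammaEdge n → ℂ
  | .plus b, .plus a => g (a - b)
  | .plus _, .minus => v
  | .minus, _ => 1

theorem GammaEdge.rank_injective [NeZero n] : Function.Injective (GammaEdge.rank : GammaEdge n → ℕ) := by
  rintro (a | _) (b | _) h
  · rw [posRep_injective h]
  · have := posRep_pos a
    simp only [rank] at h
    omega
  · have := posRep_pos b
    simp only [rank] at h
    omega
  · rfl

variable {v g}

theorem GammaEdge.twist_mul_twist (hg : ∀ a : ZMod n, a ≠ 0 → g (-a) * g a = v)
    {i j : GammaEdge n} (h : i ≠ j) : twist v g i j * twist v g j i = v := by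
  rcases i with b | _ <;> rcases j with a | _ <;> simp only [twist, mul_one, one_mul]
  · rw [← neg_sub b a, hg]
    rintro h0
    exact h (congrArg _ (sub_eq_zero.1 h0))
  · exact absurd rfl h

variable [NeZero n]

theorem RGammaGamma_eq_perkSchultz (z₁ z₂ : ℂˣ) (p q : GammaEdge n × GammaEdge n) :
    RGammaGamma v g z₁ z₂ p q =
      1 * (z₁ ^ p.1.rank * z₂ ^ p.2.rank * ((z₁ ^ q.1.rank)⁻¹ * (z₂ ^ q.2.rank)⁻¹) : ℂˣ) *
        perkSchultz v (GammaEdge.twist v g) GammaEdge.isPlus GammaEdge.rank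
          ((z₁ : ℂ) ^ n) ((z₂ : ℂ) ^ n) p q := by
  obtain ⟨c, d⟩ := p
  obtain ⟨b, a⟩ := q
  have h₁ := z₁.ne_zero
  have h₂ := z₂.ne_zero
  rcases b with b | _ <;> rcases a with a | _ <;> rcases c with c | _ <;> rcases d with d | _ <;>
    simp only [RGammaGamma, Matrix.of_apply, weightGammaGamma, perkSchultz, perkSchultzDiag,
      GammaEdge.rank, GammaEdge.isPlus, GammaEdge.twist, Prod.mk.injEq,
      Prod.swap_prod_mk, reduceCtorEq, and_false, false_and, if_false, if_true, add_zero,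
      GammaEdge.plus.injEq, mul_zero, and_true, true_and, Units.val_mul, Units.val_pow_eq_pow_val,
      Units.val_inv_eq_inv_val, zero_add]
  · by_cases hab : a = b
    · subst hab
      by_cases hc : c = a
      · subst hc
        by_cases hd : d = c
        · subst hd
          simp [perkSchultzSwap_self]
          field_simp
        · simp [hd, Ne.symm hd]
      · simp [hc, Ne.symm hc]
    · by_cases hcb : b = c
      · subst hcb
        by_cases hda : a = d
        · subst hda
          simp [hab, Ne.symm hab]
          field_simp
        · simp [hab, Ne.symm hab, hda, Ne.symm hda]
      · by_cases hca : a = c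
        · subst hca
          by_cases hdb : b = d
          · subst hdb
            simp only [hab, Ne.symm hab, if_false, if_true, and_self, pow_val_sub h₁,
              pow_sub_val_sub h₂, zero_add]
            -- The wrap-around leaves exactly one of `z₁ ^ n`, `z₂ ^ n`, the one that Perk-Schultz
            -- selects by rank.
            rcases lt_or_gt_of_ne (posRep_injective.ne hab) with h | h
            · rw [perkSchultzSwap_of_lt _ _ _ _ (by exact h), if_neg h.not_ge, if_neg h.not_ge]
              field_simp
            · rw [perkSchultzSwap_of_gt _ _ _ _ (by exact h), if_pos h.le, if_pos h.le]
              field_simp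
          · simp [hab, hcb, hdb, Ne.symm hdb]
        · simp [hab, hcb, Ne.symm hcb, hca, Ne.symm hca]
  · split_ifs with h
    · subst h
      field_simp
    · simp
  · rw [perkSchultzSwap_of_lt _ _ _ _ (by exact posRep_pos d), pow_sub_posRep h₁]
    split_ifs with h
    · subst h
      field_simp
    · simp
  · rw [perkSchultzSwap_of_gt _ _ _ _ (by exact posRep_pos c), pow_sub_posRep h₂]
    split_ifs with h
    · subst h
      field_simp
    · simp
  · split_ifs with h
    · subst h
      field_simp
    · simp
  · simp [perkSchultzSwap_self]

theorem RGammaGamma_ybe (hg : ∀ a : ZMod n, a ≠ 0 → g (-a) * g a = v) :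
    SatisfiesYBE (RGammaGamma v g) (RGammaGamma v g) (RGammaGamma v g) := by
  have h : SatisfiesYBE (fun z₁ z₂ : ℂˣ => perkSchultz v (GammaEdge.twist v g) GammaEdge.isPlus
      GammaEdge.rank ((z₁ : ℂ) ^ n) ((z₂ : ℂ) ^ n)) (fun z₁ z₂ : ℂˣ => perkSchultz v
      (GammaEdge.twist v g) GammaEdge.isPlus GammaEdge.rank ((z₁ : ℂ) ^ n) ((z₂ : ℂ) ^ n))
      (fun z₁ z₂ : ℂˣ => perkSchultz v (GammaEdge.twist v g) GammaEdge.isPlus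
      GammaEdge.rank ((z₁ : ℂ) ^ n) ((z₂ : ℂ) ^ n)) :=
    satisfiesYBE_iff.2 fun z₁ z₂ z₃ => sub_eq_zero.2 <|
      perkSchultz_ybe _ GammaEdge.rank_injective (fun _ _ => GammaEdge.twist_mul_twist hg) _ _ _
  exact h.gauge (fun _ _ => 1) (fun _ _ => 1) (fun _ _ => 1) (fun z i => z ^ i.rank)
    (fun z i => z ^ i.rank) (fun z i => z ^ i.rank) RGammaGamma_eq_perkSchultz
    RGammaGamma_eq_perkSchultz RGammaGamma_eq_perkSchultz

end GammaGamma

/-! ### `R^{ΓΔ}` by crossing -/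

section GammaDelta

variable {n : ℕ} [NeZero n] {v : ℂ} {g : ZMod n → ℂ}

theorem RGammaGamma_eq_or_eq_swap {z₁ z₂ : ℂˣ} {p q : GammaEdge n × GammaEdge n}
    (h : RGammaGamma v g z₁ z₂ p q ≠ 0) : q = p ∨ q = p.swap := by
  by_contra! h'
  rw [RGammaGamma_eq_perkSchultz] at h
  simp [perkSchultz, h'] at h

/-- The duality `-_b ↦ +_{1-b}`, `+ ↦ -` between the edges of Delta ice and of Gamma ice. -/
def DeltaEdge.dual (n : ℕ) : DeltaEdge n ≃ GammaEdge n where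
  toFun
    | .minus b => .plus (1 - b)
    | .plus => .minus
  invFun
    | .plus a => .minus (1 - a)
    | .minus => .plus
  left_inv e := by cases e <;> simp
  right_inv e := by cases e <;> simp

/-- Together with `crossingRight`, this cancels the powers of `u` that the shifted parameter `u *
z₂` brings into the weights, except those that combine to `u ^ n = v`, and adjusts signs. -/
def GammaEdge.crossingLeft (u : ℂ) : GammaEdge n → ℂ
  | .plus a => u ^ posRep a
  | .minus => -1

noncomputable def GammaEdge.crossingRight (u v : ℂ) : GammaEdge n → ℂ
  | .plus a => -(u ^ posRep a)⁻¹
  | .minus => v⁻¹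

theorem RGammaDelta_eq_crossing (hv : v ≠ 0) (u : ℂˣ) (hu : (u : ℂ) ^ n = v)
    (z₁ z₂ : ℂˣ) (p q : GammaEdge n × DeltaEdge n) :
    RGammaDelta v g z₁ z₂ p q =
      p.1.crossingLeft u * q.1.crossingRight u v *
        RGammaGamma v g (u * z₂) z₁ (DeltaEdge.dual n q.2, p.1) (DeltaEdge.dual n p.2, q.1) := by
  obtain ⟨c, d⟩ := p
  obtain ⟨a, b⟩ := q
  have h₀ := u.ne_zero
  have h₁ := z₁.ne_zero
  have h₂ := z₂.ne_zero
  rcases a with a | _ <;> rcases b with b | _ <;> rcases c with c | _ <;> rcases d with d | _ <;>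
    simp only [RGammaDelta, RGammaGamma, Matrix.of_apply, weightGammaDelta, weightGammaGamma,
      GammaEdge.crossingLeft, GammaEdge.crossingRight, DeltaEdge.dual, Equiv.coe_fn_mk, mul_zero,
      Units.val_mul, mul_pow]
  · obtain ⟨b, rfl⟩ : ∃ b', b = 1 - b' := ⟨1 - b, by ring⟩
    obtain ⟨d, rfl⟩ : ∃ d', d = 1 - d' := ⟨1 - d, by ring⟩
    have key : ∀ x y : ZMod n, x + (1 - y) = 1 ↔ x = y := fun x y =>
      ⟨fun h => by linear_combination h, fun h => by rw [h]; ring⟩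
    have key' : ∀ x y : ZMod n, x + (1 - y) - 1 = x - y := fun x y => by ring
    simp only [key, key', sub_right_inj, sub_sub_cancel]
    by_cases had : a = d
    · subst had
      by_cases hac : a = c
      · subst hac
        by_cases hba : b = a
        · subst hba
          simp [hu]
          field_simp
        · simp [hba, Ne.symm hba]
      · simp [hac, Ne.symm hac]
    · by_cases hbd : b = d
      · subst hbd
        by_cases hac : a = c
        · subst hac
          simp [had, hu]
          field_simp
          ring
        · simp [had, Ne.symm had, hac, Ne.symm hac]
      · by_cases hab : a = b
        · subst hab
          by_cases hcd : c = d
          · subst hcd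
            simp only [had, false_and, and_self, if_false, if_true, pow_val_sub h₀, pow_val_sub h₂,
              pow_sub_val_sub h₁, hu, (posRep_injective.ne (Ne.symm had)).le_iff_lt]
            split_ifs <;> field_simp <;> ring
          · simp [had, hcd]
        · simp [had, hbd, hab, Ne.symm hab]
  · by_cases h : b + a = 1
    · obtain rfl : a = 1 - b := by rw [← h]; ring
      simp only [h, if_true, pow_posRep_sub_one h₁, pow_posRep_one_sub h₁,
        pow_sub_posRep h₁]
      field_simp
    · rw [if_neg h, if_neg]
      · simp
      · rintro rfl
        exact h (by ring)
  · split_ifs with h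
    · subst h
      simp [hu]
    · simp
  · simp only [sub_right_inj]
    split_ifs with h h' h'
    · subst h
      simp [hu]
      field_simp
      ring
    · exact absurd h.symm h'
    · exact absurd h'.symm h
    · simp
  · by_cases h : c + d = 1
    · obtain rfl : d = 1 - c := by rw [← h]; ring
      simp only [h, sub_sub_cancel, if_true, pow_posRep_sub_one h₂, pow_posRep_one_sub h₂,
        pow_sub_posRep h₀, pow_sub_posRep h₂, hu]
      field_simp
    · rw [if_neg h, if_neg]
      · simp
      · rintro rfl
        exact h (by ring)
  · rw [hu]
    field_simp
    ring

theorem RGammaGamma_RGammaDelta_ybe (hv : v ≠ 0)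
    (hg : ∀ a : ZMod n, a ≠ 0 → g (-a) * g a = v) :
    SatisfiesYBE (RGammaGamma v g) (RGammaDelta v g) (RGammaDelta v g) := by
  -- The crossing shift must replace `z₂ ^ n` by `v * z₂ ^ n`.
  obtain ⟨u, hu⟩ := IsAlgClosed.exists_pow_nat_eq v (NeZero.pos n)
  have hu0 : u ≠ 0 := by
    rintro rfl
    exact hv (by rw [← hu, zero_pow (NeZero.ne n)])
  refine (RGammaGamma_ybe hg).crossing (DeltaEdge.dual n) (Units.mk0 u hu0)
    (GammaEdge.crossingLeft u) (GammaEdge.crossingRight u v) ?_ ?_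
    (RGammaDelta_eq_crossing hv (Units.mk0 u hu0) hu)
  -- A nonzero entry keeps or swaps the two labels, so any product of one-label weights is
  -- conserved.
  all_goals
    intro z₁ z₂ p q h
    rcases RGammaGamma_eq_or_eq_swap h with rfl | rfl
    · rfl
    · exact mul_comm _ _

end GammaDelta

/-! ### Passage from Gamma to Delta by transposition -/

section Delta

variable {n : ℕ} [NeZero n] {v : ℂ} {g : ZMod n → ℂ}

/-- The bijection `-_a ↦ +_a`, `+ ↦ -` that reverses spins and keeps charges. -/
def DeltaEdge.flip (n : ℕ) : DeltaEdge n ≃ GammaEdge n where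
  toFun
    | .minus a => .plus a
    | .plus => .minus
  invFun
    | .plus a => .minus a
    | .minus => .plus
  left_inv e := by cases e <;> rfl
  right_inv e := by cases e <;> rfl

/-- Accounts for the exponents that are shifted by one between Gamma and Delta weights. -/
def DeltaEdge.gauge (z : ℂˣ) : DeltaEdge n → ℂˣ
  | .minus _ => z⁻¹
  | .plus => 1

def GammaEdge.gauge (z : ℂˣ) : GammaEdge n → ℂˣ
  | .plus _ => z
  | .minus => 1

/-- The factor `(z₁ z₂) ^ n` clears the denominators created by inverting the parameters, and in
doing so interchanges `z₁ ^ n` and `z₂ ^ n`, as `‡` does. -/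
theorem ddagger_RDeltaDelta_eq (z₁ z₂ : ℂˣ) (p q : DeltaEdge n × DeltaEdge n) :
    ddagger (RDeltaDelta v g) z₁ z₂ p q =
      ((z₁ : ℂ) * z₂) ^ n * (p.1.gauge z₁ * p.2.gauge z₂ *
        ((q.1.gauge z₁)⁻¹ * (q.2.gauge z₂)⁻¹) : ℂˣ) *
        RGammaGamma v g z₁⁻¹ z₂⁻¹ (DeltaEdge.flip n q.1, DeltaEdge.flip n q.2)
          (DeltaEdge.flip n p.1, DeltaEdge.flip n p.2) := by
  obtain ⟨c, d⟩ := p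
  obtain ⟨a, b⟩ := q
  have h₁ := z₁.ne_zero
  have h₂ := z₂.ne_zero
  rw [ddagger_apply]
  rcases a with a | _ <;> rcases b with b | _ <;> rcases c with c | _ <;> rcases d with d | _ <;>
    simp only [RDeltaDelta, RGammaGamma, Matrix.of_apply, weightDeltaDelta, weightGammaGamma,
      DeltaEdge.gauge, DeltaEdge.flip, Equiv.coe_fn_mk, mul_zero, Prod.swap_prod_mk,
      Units.val_mul, mul_pow, inv_pow, Units.val_inv_eq_inv_val, Units.val_one, inv_inv, inv_one]
  · by_cases hab : a = b
    · subst hab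
      by_cases hc : c = a
      · subst hc
        by_cases hd : d = c
        · subst hd
          simp
          field_simp
        · simp [hd, Ne.symm hd]
      · by_cases hd : d = a
        · subst hd
          simp [hc, Ne.symm hc]
        · simp [hc, Ne.symm hc, hd, Ne.symm hd]
    · by_cases hda : d = a
      · subst hda
        by_cases hcb : c = b
        · subst hcb
          simp only [hab, Ne.symm hab, and_self, false_and, if_false, if_true, pow_val_sub h₁,
            pow_sub_val_sub h₂]
          rcases lt_or_gt_of_ne (posRep_injective.ne hab) with h | h
          · rw [if_pos h.le, if_pos h.le, if_neg h.not_ge, if_neg h.not_ge]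
            field_simp
          · rw [if_neg h.not_ge, if_neg h.not_ge, if_pos h.le, if_pos h.le]
            field_simp
        · simp [hab, Ne.symm hab, hcb, Ne.symm hcb]
      · by_cases hdb : d = b
        · subst hdb
          by_cases hca : c = a
          · subst hca
            simp [hab, Ne.symm hab]
            field_simp
          · simp [hab, Ne.symm hab, hca, Ne.symm hca]
        · simp [Ne.symm hab, hda, Ne.symm hda, hdb, Ne.symm hdb]
  · simp only [eq_comm (a := a)]
    split_ifs with h
    · subst h
      field_simp
    · simp
  · simp only [eq_comm (a := a)]
    split_ifs with h
    · subst h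
      rw [pow_posRep_sub_one h₂, pow_succ, pow_sub_posRep h₁, pow_sub_posRep h₂]
      field_simp
    · simp
  · simp only [eq_comm (a := b)]
    split_ifs with h
    · subst h
      rw [pow_posRep_sub_one h₁, pow_succ, pow_sub_posRep h₁, pow_sub_posRep h₂]
      field_simp
    · simp
  · simp only [eq_comm (a := b)]
    split_ifs with h
    · subst h
      field_simp
    · simp
  · field_simp

theorem ddagger_RGammaDelta_eq (z₁ z₂ : ℂˣ) (p q : DeltaEdge n × GammaEdge n) :
    ddagger (RGammaDelta v g) z₁ z₂ p q =
      ((z₁ : ℂ) * z₂) ^ n * (p.1.gauge z₁ * p.2.gauge z₂ *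
        ((q.1.gauge z₁)⁻¹ * (q.2.gauge z₂)⁻¹) : ℂˣ) *
        RGammaDelta v g z₁⁻¹ z₂⁻¹ (DeltaEdge.flip n q.1, (DeltaEdge.flip n).symm q.2)
          (DeltaEdge.flip n p.1, (DeltaEdge.flip n).symm p.2) := by
  obtain ⟨c, d⟩ := p
  obtain ⟨a, b⟩ := q
  have h₁ := z₁.ne_zero
  have h₂ := z₂.ne_zero
  rw [ddagger_apply]
  rcases a with a | _ <;> rcases b with b | _ <;> rcases c with c | _ <;> rcases d with d | _ <;>
    simp only [RGammaDelta, Matrix.of_apply, weightGammaDelta,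
      DeltaEdge.gauge, GammaEdge.gauge, DeltaEdge.flip, Equiv.coe_fn_mk, Equiv.coe_fn_symm_mk,
      mul_zero, Prod.swap_prod_mk,
      Units.val_mul, mul_pow, inv_pow, Units.val_inv_eq_inv_val, Units.val_one, inv_inv, inv_one]
  · by_cases hac : a = c
    · subst hac
      by_cases hbd : b = d
      · subst hbd
        simp only [and_self, if_true, add_comm b a]
        split_ifs <;> field_simp
      · have hda : ¬(b + a = 1 ∧ d + a = 1) := fun h => hbd (add_right_cancel (h.1.trans h.2.symm))
        have hda' : ¬(a + d = 1 ∧ a + b = 1) := by rwa [add_comm a d, add_comm a b, and_comm]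
        simp [hbd, Ne.symm hbd, hda, hda']
    · simp only [hac, Ne.symm hac, and_false, false_and, if_false]
      by_cases hb : b + a = 1
      · by_cases hd : d + c = 1
        · obtain rfl : b = 1 - a := by rw [← hb]; ring
          obtain rfl : d = 1 - c := by rw [← hd]; ring
          have h : 1 - a - (1 - c) = c - a := by ring
          simp only [hb, hd, add_sub_cancel, and_self, if_true, pow_val_sub h₁, pow_val_sub h₂,
            pow_sub_val_sub h₁, pow_sub_val_sub h₂, h]
          -- Charge duality reverses the order, so both sides fall into the same case of the weight.
          have hlt : posRep (1 - c) < posRep (1 - a) ↔ posRep a < posRep c := by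
            have := posRep_le a
            have := posRep_le c
            rw [posRep_one_sub, posRep_one_sub]
            omega
          simp only [hlt, (posRep_injective.ne hac).le_iff_lt]
          split_ifs <;> field_simp
        · simp [hd, add_comm c d]
      · simp [hb, add_comm a b]
  · split_ifs with h
    · obtain rfl : b = 1 - a := by rw [← h]; ring
      rw [pow_posRep_sub_one h₂, pow_posRep_sub_one h₂, pow_posRep_one_sub h₁,
        pow_posRep_one_sub h₂]
      field_simp
    · simp
  · simp only [eq_comm (a := a)]
    split_ifs with h
    · subst h
      field_simp
    · simp
  · simp only [eq_comm (a := b)]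
    split_ifs with h
    · subst h
      field_simp
    · simp
  · split_ifs with h
    · obtain rfl : d = 1 - c := by rw [← h]; ring
      rw [pow_posRep_sub_one h₁, pow_posRep_sub_one h₁, pow_posRep_one_sub h₁,
        pow_posRep_one_sub h₂]
      field_simp
    · simp
  · field_simp

theorem ddagger_RDeltaDelta_ybe (hg : ∀ a : ZMod n, a ≠ 0 → g (-a) * g a = v) :
    SatisfiesYBE (ddagger (RDeltaDelta v g)) (ddagger (RDeltaDelta v g))
      (ddagger (RDeltaDelta v g)) :=
  (RGammaGamma_ybe hg).transpose (DeltaEdge.flip n) (DeltaEdge.flip n) (DeltaEdge.flip n)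
    (fun z₁ z₂ => ((z₁ : ℂ) * z₂) ^ n) (fun z₁ z₂ => ((z₁ : ℂ) * z₂) ^ n)
    (fun z₁ z₂ => ((z₁ : ℂ) * z₂) ^ n) DeltaEdge.gauge DeltaEdge.gauge DeltaEdge.gauge
    ddagger_RDeltaDelta_eq ddagger_RDeltaDelta_eq ddagger_RDeltaDelta_eq

theorem ddagger_RDeltaDelta_ddagger_RGammaDelta_ybe (hv : v ≠ 0)
    (hg : ∀ a : ZMod n, a ≠ 0 → g (-a) * g a = v) :
    SatisfiesYBE (ddagger (RDeltaDelta v g)) (ddagger (RGammaDelta v g))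
      (ddagger (RGammaDelta v g)) :=
  (RGammaGamma_RGammaDelta_ybe hv hg).transpose (DeltaEdge.flip n) (DeltaEdge.flip n)
    (DeltaEdge.flip n).symm
    (fun z₁ z₂ => ((z₁ : ℂ) * z₂) ^ n) (fun z₁ z₂ => ((z₁ : ℂ) * z₂) ^ n)
    (fun z₁ z₂ => ((z₁ : ℂ) * z₂) ^ n) DeltaEdge.gauge DeltaEdge.gauge GammaEdge.gauge
    ddagger_RDeltaDelta_eq ddagger_RGammaDelta_eq ddagger_RGammaDelta_eq

end Delta

/-! ### The product of the nondiagonal blocks -/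

section Block

/-- Up to conjugation by a diagonal matrix, the entries of `R^{ΔΓ}` on the span of the vectors
`-_b ⊗ +_a` with `a + b = 1` and `+ ⊗ -`; here `x = z₁ ^ n`, `y = z₂ ^ n`. -/
noncomputable def blockDeltaGamma (n : ℕ) (v x y : ℂ) (k m : ℕ) : ℂ :=
  if m = k then (if k = 0 then y - v ^ (n + 1) * x else v ^ n * v⁻¹ * x - y)
  else (1 - v) * v ^ m * (v ^ (k + 1))⁻¹ *
    (if k < m then y else if m = 0 then v ^ (n + 1) * x else v ^ n * x)

/-- Up to conjugation by a diagonal matrix, the entries of `(R^{ΓΔ})^‡` on the same space. -/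
noncomputable def blockGammaDelta (v x y : ℂ) (m i : ℕ) : ℂ :=
  if m = i then (if i = 0 then y - x else v ^ 2 * x - y)
  else (1 - v) * (if m < i then (if m = 0 then y else -y) else if i = 0 then x else -(v * x))

theorem sum_Ico_mul_geom {v : ℂ} {f : ℕ → ℂ} {a b : ℕ} (hab : a ≤ b) (c : ℂ)
    (hf : ∀ m ∈ Finset.Ico a b, f m = c * ((1 - v) * v ^ m)) :
    ∑ m ∈ Finset.Ico a b, f m = c * (v ^ a - v ^ b) := by
  rw [Finset.sum_congr rfl hf, ← Finset.mul_sum, ← Finset.mul_sum, mul_comm (1 - v),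
    geom_sum_Ico_mul_neg v hab]

theorem sum_Ico_eq_add_add {f : ℕ → ℂ} {a b c : ℕ} (hac : a ≤ c) (hcb : c < b) :
    ∑ m ∈ Finset.Ico a b, f m =
      ∑ m ∈ Finset.Ico a c, f m + f c + ∑ m ∈ Finset.Ico (c + 1) b, f m := by
  rw [← Finset.sum_Ico_consecutive f hac hcb.le, Finset.sum_eq_sum_Ico_succ_bot hcb, add_assoc]

/-- Away from `m = 0, i, k` the summand is a constant times `(1 - v) * v ^ m` on each interval cut
out by these points, so each partial sum telescopes; a rational identity in each relative position
of `0, i, k` remains. -/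
theorem sum_blockDeltaGamma_mul_blockGammaDelta {n : ℕ} {v : ℂ} (hv : v ≠ 0)
    (x y : ℂ) {i k : ℕ} (hi : i ≤ n) (hk : k ≤ n) :
    ∑ m ∈ Finset.range (n + 1), blockDeltaGamma n v x y k m * blockGammaDelta v x y m i =
      if i = k then (y - v ^ n * x) * (y - v * x) else 0 := by
  -- The index `0` stands for `+ ⊗ -`, whose entries have other coefficients, so it is split off.
  rw [Finset.range_eq_Ico, Finset.sum_eq_sum_Ico_succ_bot n.succ_pos, zero_add]
  have hlow : ∀ b, 1 ≤ b → b ≤ i → b ≤ k →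
      ∑ m ∈ Finset.Ico 1 b, blockDeltaGamma n v x y k m * blockGammaDelta v x y m i =
        (v ^ (k + 1))⁻¹ * (v ^ n * x) * ((1 - v) * -y) * (v ^ 1 - v ^ b) := by
    intro b hb hbi hbk
    refine sum_Ico_mul_geom hb _ fun m hm => ?_
    rw [Finset.mem_Ico] at hm
    rw [blockDeltaGamma, blockGammaDelta, if_neg (by omega), if_neg (by omega), if_neg (by omega),
      if_neg (by omega), if_pos (by omega), if_neg (by omega)]
    ring
  have hhigh : ∀ a, i < a → k < a → a ≤ n + 1 →
      ∑ m ∈ Finset.Ico a (n + 1), blockDeltaGamma n v x y k m * blockGammaDelta v x y m i =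
        (v ^ (k + 1))⁻¹ * y * ((1 - v) * (if i = 0 then x else -(v * x))) *
          (v ^ a - v ^ (n + 1)) := by
    intro a hia hka han
    refine sum_Ico_mul_geom han _ fun m hm => ?_
    rw [Finset.mem_Ico] at hm
    rw [blockDeltaGamma, blockGammaDelta, if_neg (by omega), if_pos (by omega), if_neg (by omega),
      if_neg (by omega)]
    ring
  have hmid1 : ∀ a, i < a → a ≤ k →
      ∑ m ∈ Finset.Ico a k, blockDeltaGamma n v x y k m * blockGammaDelta v x y m i =
        (v ^ (k + 1))⁻¹ * (v ^ n * x) * ((1 - v) * (if i = 0 then x else -(v * x))) *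
          (v ^ a - v ^ k) := by
    intro a hia hak
    refine sum_Ico_mul_geom hak _ fun m hm => ?_
    rw [Finset.mem_Ico] at hm
    rw [blockDeltaGamma, blockGammaDelta, if_neg (by omega), if_neg (by omega), if_neg (by omega),
      if_neg (by omega), if_neg (by omega)]
    ring
  have hmid2 : ∀ a, k < a → a ≤ i →
      ∑ m ∈ Finset.Ico a i, blockDeltaGamma n v x y k m * blockGammaDelta v x y m i =
        (v ^ (k + 1))⁻¹ * y * ((1 - v) * -y) * (v ^ a - v ^ i) := by
    intro a hka hai
    refine sum_Ico_mul_geom hai _ fun m hm => ?_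
    rw [Finset.mem_Ico] at hm
    rw [blockDeltaGamma, blockGammaDelta, if_neg (by omega), if_pos (by omega), if_neg (by omega),
      if_pos (by omega), if_neg (by omega)]
    ring
  rcases lt_trichotomy i k with hik | rfl | hik
  · rcases i.eq_zero_or_pos with rfl | hi0
    · rw [sum_Ico_eq_add_add hik (Nat.lt_succ_of_le hk), hmid1 1 Nat.one_pos hik,
        hhigh (k + 1) (by omega) (by omega) (by omega)]
      simp [blockDeltaGamma, blockGammaDelta, hik.ne, hik.ne']
      field_simp
      ring
    · rw [sum_Ico_eq_add_add (show 1 ≤ i by omega) (show i < n + 1 by omega),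
        sum_Ico_eq_add_add (show i + 1 ≤ k by omega) (show k < n + 1 by omega),
        hlow i hi0 le_rfl hik.le, hmid1 (i + 1) (by omega) (by omega),
        hhigh (k + 1) (by omega) (by omega) (by omega)]
      have h0 : k ≠ 0 := by omega
      simp [blockDeltaGamma, blockGammaDelta, hik.ne, hik.ne', hi0, hi0.ne, hi0.ne', h0, h0.symm,
        hik.not_gt]
      field_simp
      ring
  · rcases i.eq_zero_or_pos with rfl | hi0
    · rw [hhigh 1 (by omega) (by omega) (by omega)]
      simp [blockDeltaGamma, blockGammaDelta]
      field_simp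
      ring
    · rw [sum_Ico_eq_add_add (show 1 ≤ i by omega) (show i < n + 1 by omega),
        hlow i hi0 le_rfl le_rfl, hhigh (i + 1) (by omega) (by omega) (by omega)]
      simp [blockDeltaGamma, blockGammaDelta, hi0, hi0.ne, hi0.ne']
      field_simp
      ring
  · rcases k.eq_zero_or_pos with rfl | hk0
    · rw [sum_Ico_eq_add_add (show 1 ≤ i by omega) (show i < n + 1 by omega),
        hmid2 1 (by omega) (by omega), hhigh (i + 1) (by omega) (by omega) (by omega)]
      simp [blockDeltaGamma, blockGammaDelta, hik, hik.ne, hik.ne']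
      field_simp
      ring
    · rw [sum_Ico_eq_add_add (show 1 ≤ k by omega) (show k < n + 1 by omega),
        sum_Ico_eq_add_add (show k + 1 ≤ i by omega) (show i < n + 1 by omega),
        hlow k hk0 hik.le le_rfl, hmid2 (k + 1) (by omega) (by omega),
        hhigh (i + 1) (by omega) (by omega) (by omega)]
      have h0 : i ≠ 0 := by omega
      simp [blockDeltaGamma, blockGammaDelta, hik, hik.ne, hik.ne', hk0.ne, hk0.ne', h0,
        h0.symm, hk0.trans hik]
      field_simp
      ring

end Block

/-! ### `R^{ΔΓ}` times `(R^{ΓΔ})^‡` -/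

section DeltaGamma

variable {n : ℕ} {v : ℂ} {g : ZMod n → ℂ}

/-- Confines the off-diagonal entries to the block of pairs of dual edges; every other basis vector
is an eigenvector. -/
theorem RDeltaGamma_eq_zero {z₁ z₂ : ℂˣ} {p q : DeltaEdge n × GammaEdge n} (hpq : p ≠ q)
    (h : ¬(DeltaEdge.dual n p.1 = p.2 ∧ DeltaEdge.dual n q.1 = q.2)) :
    RDeltaGamma v g z₁ z₂ p q = 0 := by
  obtain ⟨c, d⟩ := p
  obtain ⟨a, b⟩ := q
  rcases a with a | _ <;> rcases b with b | _ <;> rcases c with c | _ <;> rcases d with d | _ <;>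
    simp [RDeltaGamma, weightDeltaGamma, DeltaEdge.dual, sub_eq_iff_eq_add] at h hpq ⊢ <;>
    grind

variable [NeZero n]

theorem GammaEdge.sum_rank (f : ℕ → ℂ) :
    ∑ e : GammaEdge n, f e.rank = ∑ m ∈ Finset.range (n + 1), f m := by
  refine Finset.sum_bij (fun e _ => e.rank) ?_ (fun a _ b _ h => rank_injective h) ?_
    fun _ _ => rfl
  · rintro (a | _) _
    · exact Finset.mem_range.2 (Nat.lt_succ_of_le (posRep_le a))
    · exact Finset.mem_range.2 n.succ_pos
  · intro m hm
    rcases m.eq_zero_or_pos with rfl | h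
    · exact ⟨.minus, Finset.mem_univ _, rfl⟩
    · exact ⟨.plus m, Finset.mem_univ _, posRep_natCast h (Finset.mem_range_succ_iff.1 hm)⟩

theorem GammaEdge.rank_le (e : GammaEdge n) : e.rank ≤ n := by
  cases e
  · exact posRep_le _
  · exact n.zero_le

theorem RDeltaGamma_eq_block (hv : v ≠ 0) (z₁ z₂ : ℂˣ) (k m : GammaEdge n) :
    RDeltaGamma v g z₁ z₂ ((DeltaEdge.dual n).symm k, k) ((DeltaEdge.dual n).symm m, m) =
      ((z₂ : ℂ) / z₁) ^ k.rank * (((z₂ : ℂ) / z₁) ^ m.rank)⁻¹ *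
        blockDeltaGamma n v ((z₁ : ℂ) ^ n) ((z₂ : ℂ) ^ n) k.rank m.rank := by
  have h₁ := z₁.ne_zero
  have h₂ := z₂.ne_zero
  rcases k with c | _ <;> rcases m with a | _ <;>
    simp only [RDeltaGamma, Matrix.of_apply, weightDeltaGamma, DeltaEdge.dual,
      Equiv.coe_fn_symm_mk, GammaEdge.rank, sub_add_cancel, if_true, and_self,
      sub_right_inj] <;>
    simp only [blockDeltaGamma, div_pow]
  · by_cases hac : a = c
    · subst hac
      have := posRep_pos a
      rw [if_pos rfl, if_pos rfl, if_neg (by omega), pow_sub₀ v hv NeZero.one_le]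
      field_simp
    · have hv' : (1 - c - (1 - a) : ZMod n) = a - c := by ring
      have h1 : 1 ≤ (a - c).val := Nat.one_le_iff_ne_zero.2 fun h =>
        hac (sub_eq_zero.1 ((ZMod.val_eq_zero _).1 h))
      have := posRep_pos a
      rw [if_neg hac, if_neg (posRep_injective.ne hac), hv', pow_sub₀ v hv h1, pow_val_sub hv,
        pow_val_sub h₁, pow_sub_val_sub h₂, if_neg (show posRep a ≠ 0 by omega)]
      simp only [(posRep_injective.ne (Ne.symm hac)).le_iff_lt]
      split_ifs <;> field_simp <;> ring
  · have := posRep_pos c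
    rw [if_neg (show 0 ≠ posRep c by omega), if_neg (by omega), pow_posRep_sub_one hv,
      pow_posRep_sub_one h₁, pow_posRep_one_sub hv, pow_posRep_one_sub h₁]
    simp
    field_simp
    ring
  · have := posRep_pos a
    rw [if_neg (show posRep a ≠ 0 by omega), if_pos (show 0 < posRep a by omega),
      pow_posRep_sub_one hv, pow_posRep_sub_one h₂, pow_posRep_one_sub h₂]
    simp
    field_simp
  · simp

theorem ddagger_RGammaDelta_eq_block (z₁ z₂ : ℂˣ) (k m : GammaEdge n) :
    ddagger (RGammaDelta v g) z₁ z₂ ((DeltaEdge.dual n).symm k, k)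
        ((DeltaEdge.dual n).symm m, m) =
      ((z₂ : ℂ) / z₁) ^ k.rank * (((z₂ : ℂ) / z₁) ^ m.rank)⁻¹ *
        blockGammaDelta v ((z₁ : ℂ) ^ n) ((z₂ : ℂ) ^ n) k.rank m.rank := by
  have h₁ := z₁.ne_zero
  have h₂ := z₂.ne_zero
  rw [ddagger_apply]
  rcases k with c | _ <;> rcases m with a | _ <;>
    simp only [RGammaDelta, Matrix.of_apply, weightGammaDelta, DeltaEdge.dual, Prod.swap_prod_mk,
      Equiv.coe_fn_symm_mk, GammaEdge.rank, add_sub_cancel, if_true, and_self,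
      sub_right_inj] <;>
    simp only [blockGammaDelta, div_pow]
  · by_cases hac : a = c
    · subst hac
      have := posRep_pos a
      rw [if_pos rfl, if_pos rfl, if_neg (by omega)]
      field_simp
    · have := posRep_pos a
      have := posRep_pos c
      rw [if_neg hac, if_neg (posRep_injective.ne (Ne.symm hac)),
        if_neg (show posRep c ≠ 0 by omega), if_neg (show posRep a ≠ 0 by omega),
        pow_val_sub h₁, pow_sub_val_sub h₂]
      simp only [(posRep_injective.ne (Ne.symm hac)).le_iff_lt]
      split_ifs <;> field_simp <;> ring
  · have := posRep_pos c
    rw [if_neg (show posRep c ≠ 0 by omega), if_neg (by omega), pow_posRep_sub_one h₁,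
      pow_posRep_one_sub h₁]
    field_simp
    simp
  · have := posRep_pos a
    rw [if_neg (show 0 ≠ posRep a by omega), if_pos (show 0 < posRep a by omega),
      if_pos (sub_add_cancel 1 a), if_pos trivial, pow_posRep_sub_one h₂, pow_posRep_one_sub h₂]
    field_simp
  · simp

theorem ddagger_RGammaDelta_eq_zero {z₁ z₂ : ℂˣ} {p q : DeltaEdge n × GammaEdge n} (hpq : p ≠ q)
    (h : ¬(DeltaEdge.dual n p.1 = p.2 ∧ DeltaEdge.dual n q.1 = q.2)) :
    ddagger (RGammaDelta v g) z₁ z₂ p q = 0 := by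
  obtain ⟨c, d⟩ := p
  obtain ⟨a, b⟩ := q
  rw [ddagger_apply]
  rcases a with a | _ <;> rcases b with b | _ <;> rcases c with c | _ <;> rcases d with d | _ <;>
    simp [RGammaDelta, weightGammaDelta, DeltaEdge.dual, sub_eq_iff_eq_add] at h hpq ⊢ <;>
    grind

theorem RDeltaGamma_mul_diag (hv : v ≠ 0) (hg : ∀ a : ZMod n, a ≠ 0 → g (-a) * g a = v)
    (z₁ z₂ : ℂˣ) {q : DeltaEdge n × GammaEdge n} (h : DeltaEdge.dual n q.1 ≠ q.2) :
    RDeltaGamma v g z₁ z₂ q q * ddagger (RGammaDelta v g) z₁ z₂ q q =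
      ((z₂ : ℂ) ^ n - v ^ n * (z₁ : ℂ) ^ n) * ((z₂ : ℂ) ^ n - v * (z₁ : ℂ) ^ n) := by
  obtain ⟨a, b⟩ := q
  rw [ddagger_apply]
  rcases a with a | _ <;> rcases b with b | _ <;>
    simp [RGammaDelta, RDeltaGamma, weightGammaDelta, weightDeltaGamma, DeltaEdge.dual] at h ⊢
  have h1 : a + b ≠ 1 := fun h1 => h (by rw [← h1]; ring)
  have h2 : a + b - 1 ≠ 0 := sub_ne_zero.2 h1
  have h3 : g (a + b - 1) ≠ 0 := fun h3 => hv (by rw [← hg _ h2, h3, mul_zero])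
  simp only [h1, add_comm b a, if_false]
  field_simp

theorem RDeltaGamma_mul_ddagger_RGammaDelta (hv : v ≠ 0)
    (hg : ∀ a : ZMod n, a ≠ 0 → g (-a) * g a = v) (z₁ z₂ : ℂˣ) :
    RDeltaGamma v g z₁ z₂ * ddagger (RGammaDelta v g) z₁ z₂ =
      (((z₂ : ℂ) ^ n - v ^ n * (z₁ : ℂ) ^ n) * ((z₂ : ℂ) ^ n - v * (z₁ : ℂ) ^ n)) •
        (1 : Matrix (DeltaEdge n × GammaEdge n) (DeltaEdge n × GammaEdge n) ℂ) := by
  ext p q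
  rw [Matrix.mul_apply, Matrix.smul_apply, smul_eq_mul, Matrix.one_apply, mul_ite, mul_one,
    mul_zero]
  by_cases hq : DeltaEdge.dual n q.1 = q.2
  · by_cases hp : DeltaEdge.dual n p.1 = p.2
    · obtain ⟨i, rfl⟩ : ∃ i, q = ((DeltaEdge.dual n).symm i, i) :=
        ⟨q.2, Prod.ext ((DeltaEdge.dual n).eq_symm_apply.2 hq) rfl⟩
      obtain ⟨k, rfl⟩ : ∃ k, p = ((DeltaEdge.dual n).symm k, k) :=
        ⟨p.2, Prod.ext ((DeltaEdge.dual n).eq_symm_apply.2 hp) rfl⟩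
      have h₁ := z₁.ne_zero
      have h₂ := z₂.ne_zero
      have hz : ((z₂ : ℂ) / z₁) ≠ 0 := div_ne_zero h₂ h₁
      rw [Fintype.sum_prod_type_right, Finset.sum_congr rfl fun m _ =>
        Finset.sum_eq_single ((DeltaEdge.dual n).symm m) (fun x _ hx => ?_) (by simp)]
      · have hsum := sum_blockDeltaGamma_mul_blockGammaDelta hv ((z₁ : ℂ) ^ n) ((z₂ : ℂ) ^ n)
          i.rank_le k.rank_le
        rw [← GammaEdge.sum_rank] at hsum
        -- Restores the diagonal conjugation by powers of `z₂ / z₁`; its factors at the summed index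
        -- cancel.
        have := congrArg (fun w =>
          ((z₂ : ℂ) / z₁) ^ k.rank * (((z₂ : ℂ) / z₁) ^ i.rank)⁻¹ * w) hsum
        simp only [Finset.mul_sum, GammaEdge.rank_injective.eq_iff] at this
        convert this using 1
        · refine Finset.sum_congr rfl fun m _ => ?_
          rw [RDeltaGamma_eq_block hv, ddagger_RGammaDelta_eq_block]
          field_simp
        · by_cases hik : i = k
          · subst hik
            simp
          · simp [hik, Ne.symm hik]
      · have hx' : DeltaEdge.dual n x ≠ m := fun h => hx (by rw [← h]; simp)
        rw [ddagger_RGammaDelta_eq_zero _ (fun h => hx' h.1), mul_zero]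
        exact fun h => hx' (by
          rw [show x = (DeltaEdge.dual n).symm i from congrArg Prod.fst h, Equiv.apply_symm_apply]
          exact (congrArg Prod.snd h).symm)
    · have hpq : p ≠ q := by
        rintro rfl
        exact hp hq
      rw [if_neg hpq]
      refine Finset.sum_eq_zero fun m _ => ?_
      by_cases hpm : p = m
      · subst hpm
        rw [ddagger_RGammaDelta_eq_zero hpq fun h => hp h.1, mul_zero]
      · rw [RDeltaGamma_eq_zero hpm fun h => hp h.1, zero_mul]
  · rw [Finset.sum_eq_single q (fun m _ hm => ?_) (by simp)]
    · split_ifs with h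
      · subst h
        exact RDeltaGamma_mul_diag hv hg z₁ z₂ hq
      · rw [RDeltaGamma_eq_zero h fun h => hq h.2, zero_mul]
    · rw [ddagger_RGammaDelta_eq_zero hm fun h => hq h.2, mul_zero]

end DeltaGamma

/-! ### Invertibility of `R^{ΔΓ}` -/

section Inverse

variable {n : ℕ} [NeZero n] {v : ℂ} {g : ZMod n → ℂ} {z₁ z₂ : ℂˣ}

/-- The vector `+ ⊗ +₀` is an eigenvector with eigenvalue `z₂ⁿ - vⁿ z₁ⁿ`. -/
theorem ne_of_isUnit_RDeltaGamma (h : IsUnit (RDeltaGamma v g z₁ z₂)) :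
    (z₂ : ℂ) ^ n ≠ v ^ n * (z₁ : ℂ) ^ n := by
  intro h0
  refine ((Matrix.isUnit_iff_isUnit_det _).1 h).ne_zero
    (Matrix.det_eq_zero_of_column_eq_zero (DeltaEdge.plus, GammaEdge.plus 0) fun p => ?_)
  by_cases hp : p = (DeltaEdge.plus, GammaEdge.plus 0)
  · subst hp
    simp [RDeltaGamma, weightDeltaGamma, h0]
  · exact RDeltaGamma_eq_zero hp fun h => by simpa [DeltaEdge.dual] using h.2

/-- Otherwise the scalar product formula forces `(R^{ΓΔ})^‡ = 0`. Its entry at `+ ⊗ -` is then `(v -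
1) z₁ⁿ`, so `v = 1`, and the other excluded equality holds. -/
theorem ne_of_isUnit_RDeltaGamma' (hv : v ≠ 0)
    (hg : ∀ a : ZMod n, a ≠ 0 → g (-a) * g a = v) (h : IsUnit (RDeltaGamma v g z₁ z₂)) :
    (z₂ : ℂ) ^ n ≠ v * (z₁ : ℂ) ^ n := by
  intro h0
  have h1 := RDeltaGamma_mul_ddagger_RGammaDelta hv hg z₁ z₂
  rw [sub_eq_zero.2 h0, mul_zero, zero_smul, h.mul_right_eq_zero] at h1
  have h2 := congrFun (congrFun h1 (.plus, .minus)) (.plus, .minus)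
  rw [ddagger_apply] at h2
  simp only [Prod.swap_prod_mk, RGammaDelta, Matrix.of_apply, weightGammaDelta,
    Matrix.zero_apply, h0] at h2
  have h3 : v = 1 := by
    have : (v - 1) * (z₁ : ℂ) ^ n = 0 := by rw [← h2]; ring
    exact sub_eq_zero.1 ((mul_eq_zero.1 this).resolve_right (pow_ne_zero n z₁.ne_zero))
  exact ne_of_isUnit_RDeltaGamma h (by rw [h0, h3, one_pow])

theorem isUnit_RDeltaGamma (hv : v ≠ 0) (hg : ∀ a : ZMod n, a ≠ 0 → g (-a) * g a = v)
    (h1 : (z₂ : ℂ) ^ n ≠ v ^ n * (z₁ : ℂ) ^ n) (h2 : (z₂ : ℂ) ^ n ≠ v * (z₁ : ℂ) ^ n) :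
    IsUnit (RDeltaGamma v g z₁ z₂) := by
  have h := RDeltaGamma_mul_ddagger_RGammaDelta hv hg z₁ z₂
  have hs := mul_ne_zero (sub_ne_zero.2 h1) (sub_ne_zero.2 h2)
  generalize ((z₂ : ℂ) ^ n - v ^ n * (z₁ : ℂ) ^ n) * ((z₂ : ℂ) ^ n - v * (z₁ : ℂ) ^ n) = s at h hs
  refine IsUnit.of_mul_eq_one (s⁻¹ • ddagger (RGammaDelta v g) z₁ z₂) ?_
  rw [Matrix.mul_smul, h, smul_smul, inv_mul_cancel₀ hs, one_smul]

theorem ddagger_RGammaDelta_eq_smul_inv (hv : v ≠ 0)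
    (hg : ∀ a : ZMod n, a ≠ 0 → g (-a) * g a = v) (h : IsUnit (RDeltaGamma v g z₁ z₂)) :
    ddagger (RGammaDelta v g) z₁ z₂ =
      (((z₂ : ℂ) ^ n - v ^ n * (z₁ : ℂ) ^ n) * ((z₂ : ℂ) ^ n - v * (z₁ : ℂ) ^ n)) •
        (RDeltaGamma v g z₁ z₂)⁻¹ := by
  rw [← Matrix.nonsing_inv_mul_cancel_left (RDeltaGamma v g z₁ z₂)
    (ddagger (RGammaDelta v g) z₁ z₂) ((Matrix.isUnit_iff_isUnit_det _).1 h),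
    RDeltaGamma_mul_ddagger_RGammaDelta hv hg, Matrix.mul_smul, mul_one]

theorem exists_inv_RDeltaGamma_eq_smul (hv : v ≠ 0)
    (hg : ∀ a : ZMod n, a ≠ 0 → g (-a) * g a = v) :
    ∃ c : ℂˣ → ℂˣ → ℂ, ∀ z₁ z₂,
      (RDeltaGamma v g z₁ z₂)⁻¹ = c z₁ z₂ • ddagger (RGammaDelta v g) z₁ z₂ := by
  suffices ∀ z₁ z₂, ∃ c : ℂ,
      (RDeltaGamma v g z₁ z₂)⁻¹ = c • ddagger (RGammaDelta v g) z₁ z₂ by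
    choose c hc using this
    exact ⟨c, hc⟩
  intro z₁ z₂
  by_cases h : IsUnit (RDeltaGamma v g z₁ z₂)
  · refine ⟨(((z₂ : ℂ) ^ n - v ^ n * (z₁ : ℂ) ^ n) * ((z₂ : ℂ) ^ n - v * (z₁ : ℂ) ^ n))⁻¹, ?_⟩
    rw [ddagger_RGammaDelta_eq_smul_inv hv hg h, smul_smul, inv_mul_cancel₀, one_smul]
    exact mul_ne_zero (sub_ne_zero.2 (ne_of_isUnit_RDeltaGamma h))
      (sub_ne_zero.2 (ne_of_isUnit_RDeltaGamma' hv hg h))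
  -- The matrix inverse is `0` by convention here, so the scalar `0` makes the proportionality hold
  -- at all parameters.
  · refine ⟨0, ?_⟩
    rw [zero_smul, Matrix.nonsing_inv_apply_not_isUnit _
      (mt (Matrix.isUnit_iff_isUnit_det _).2 h)]

end Inverse

/-! ### Assembly of the Yang-Baxter system -/

theorem mainTheorem3 (n : ℕ) [NeZero n] (v : ℂ) (hv : v ≠ 0) (g : ZMod n → ℂ)
    (hg0 : g 0 = -v) (hg : ∀ a : ZMod n, a ≠ 0 → g (-a) * g a = v) :
    IsYangBaxterSystem (RGammaGamma v g) (fun z₁ z₂ => (RDeltaGamma v g z₁ z₂)⁻¹)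
        (RGammaDelta v g) (ddagger (RDeltaDelta v g)) ∧
      (∃ c : ℂˣ → ℂˣ → ℂ, ∀ z₁ z₂ : ℂˣ, IsUnit (RDeltaGamma v g z₁ z₂) →
        c z₁ z₂ ≠ 0 ∧
          ddagger (RGammaDelta v g) z₁ z₂ = c z₁ z₂ • (RDeltaGamma v g z₁ z₂)⁻¹) ∧
      (∀ z₁ z₂ : ℂˣ, (z₂ : ℂ) ^ n ≠ v ^ n * (z₁ : ℂ) ^ n → (z₂ : ℂ) ^ n ≠ v * (z₁ : ℂ) ^ n →
        IsUnit (RDeltaGamma v g z₁ z₂)) := by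
  refine ⟨?_, ⟨fun z₁ z₂ => ((z₂ : ℂ) ^ n - v ^ n * (z₁ : ℂ) ^ n) * ((z₂ : ℂ) ^ n -
    v * (z₁ : ℂ) ^ n), fun z₁ z₂ h => ⟨mul_ne_zero (sub_ne_zero.2 (ne_of_isUnit_RDeltaGamma h))
      (sub_ne_zero.2 (ne_of_isUnit_RDeltaGamma' hv hg h)),
    ddagger_RGammaDelta_eq_smul_inv hv hg h⟩⟩, fun z₁ z₂ => isUnit_RDeltaGamma hv hg⟩
  obtain ⟨c, hc⟩ := exists_inv_RDeltaGamma_eq_smul (g := g) hv hg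
  -- Since `‡` is an involution that exchanges the parameters, `B^‡` is a multiple of `C`, with the
  -- arguments of `c` reversed.
  have hc' : ∀ z₁ z₂, ddagger (fun z₁ z₂ => (RDeltaGamma v g z₁ z₂)⁻¹) z₁ z₂ =
      c z₂ z₁ • RGammaDelta v g z₁ z₂ := by
    intro z₁ z₂
    ext p q
    rw [ddagger_apply, hc, Matrix.smul_apply, ddagger_apply, Matrix.smul_apply, Prod.swap_swap,
      Prod.swap_swap]
  have hA := RGammaGamma_RGammaDelta_ybe hv hg
  have hD := ddagger_RDeltaDelta_ddagger_RGammaDelta_ybe hv hg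
  have h1 : ∀ {ι κ : Type} (X : ParamEnd ι κ) (z₁ z₂ : ℂˣ),
      X z₁ z₂ = (fun _ _ => (1 : ℂ)) z₁ z₂ • X z₁ z₂ := fun X z₁ z₂ => (one_smul ℂ _).symm
  exact {
    aaa := satisfiesYBE_iff.1 (RGammaGamma_ybe hg)
    acc := satisfiesYBE_iff.1 hA
    abb := satisfiesYBE_iff.1 (hA.smul _ _ hc' hc')
    acb := satisfiesYBE_iff.1 (hA.smul _ _ (h1 _) hc')
    ddd := satisfiesYBE_iff.1 (ddagger_RDeltaDelta_ybe hg)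
    dbb := satisfiesYBE_iff.1 (hD.smul _ _ hc hc)
    dcc := satisfiesYBE_iff.1 hD
    dbc := satisfiesYBE_iff.1 (hD.smul _ _ hc (h1 _)) }
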